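/- Let $A\in\mathbb{R}^{d\times d}$ be a covariance (symmetric positive semidefinite) matrix, $\gamma\in\mathbb{R}^d$, and $\nu$ a positive measure on $\mathbb{R}^d$ with $\int\min(|s|^2,1)\,\nu(ds)<\infty$, and let $$f(z)=\tfrac12\langle z,Az\rangle-i\langle\gamma,z\rangle+\int_{\mathbb{R}^d}\bigl(1+i\langle z,s\rangle\mathbf 1_{|s|<1}-e^{i\langle z,s\rangle}\bigr)\,\nu(ds).$$ A stream is a finite sequence of updates $(v,y)\in[n]\times\mathbb{R}^d$; its frequency vector $\mathbf{x}\in(\mathbb{R}^d)^n$ starts at $0$ and each update performs $\mathbf{x}(v)\gets\mathbf{x}(v)+y$. Put $f(\mathbf{x})=\sum_{v\in[n]}f(\mathbf{x}(v))$. Let $X^{(v,j)}$, $v\in[n]$, $j\in[m]$, be i.i.d. copies (supplied by a random oracle that is not charged for memory) of a Lévy process $X$ on $\mathbb{R}^d$ (stationary independent increments, $X_0=0$ a.s., stochastically continuous) with $\mathbb{E}\,e^{i\langle X_t,z\rangle}=e^{-tf(z)}$ for all $t\ge0$, $z\in\mathbb{R}^d$. The *Lévy-Tower* with $m$ copies and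 maximum level $K$ stores $m(K+1)$ registers $S_k^{(j)}\in\mathbb{R}/2\pi\mathbb{Z}$, $0\le k\le K$, $j\in[m]$, initially $0$; an update $(v,y)$ performs $S_k^{(j)}\gets S_k^{(j)}+\langle y,X^{(v,j)}_{2^{-k}}\rangle \bmod 2\pi$. Its estimate $\widehat{f(\mathbf{x})}$ is obtained by scanning $k=K,K-1,\dots,0$ and returning $-2^k\log Y_k$ (principal branch) at the first $k$ with $|1-Y_k|>0.2$, where $Y_k=\frac1m\sum_{j=1}^m e^{iS_k^{(j)}}$ (and $0$ if there is no such $k$). (1) There are absolute constants $C>0$ and $m_0$ such that for all $d,A,\gamma,\nu,n$, all $m\ge m_0$, all $K$ and every stream with $|f(\mathbf{x})|\ge1$ and $\log_2|f(\mathbf{x})|\le K$, with probability at least $99/100$, $$\bigl|\widehat{f(\mathbf{x})}-f(\mathbf{x})\bigr|\le C\,|f(\mathbf{x})|/\sqrt m .$$ (2) For every $c\in\mathbb{N}$ there is $C>0$ such that for all $n\ge2$ and $0<\varepsilon\le1$ there are $m,K,b\in\mathbb{N}$ with $b\le C\log(n/\varepsilon)$ such that for all $d,A,\gamma,\nu$: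 i.i.d. Lévy processes $X^{(v,j)}$ as above exist, and for any such processes the Lévy-Tower with parameters $m,K$ consists of at most $C\varepsilon^{-2}\log n$ words (one per register), is mergeable (the memory for the concatenation of two streams is computed from the memories for the two streams), and, for every stream with $1\le|f(\mathbf{x})|\le n^c$, satisfies with probability at least $99/100$ $$\bigl|\widehat{f(\mathbf{x})}-f(\mathbf{x})\bigr|\le\varepsilon|f(\mathbf{x})| .$$ Words of $b$ bits suffice if the number of updates is polynomially bounded: the tower whose registers hold elements of $\mathbb{Z}/2^b$, read as multiples of $2\pi/2^b$, with each projection rounded to the nearest such multiple, has the same number of words, is mergeable, and satisfies the same guarantee for every such stream with at most $n^c$ updates. (For $1/\varepsilon\le\operatorname{poly}(n)$ one has $b=O(\log n)$.) -/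

import Mathlib

open MeasureTheory ProbabilityTheory
open scoped NNReal ENNReal Matrix

namespace LevySketch

/-! ### Lévy–Khintchine exponents -/

/-- The function
`f(z) = ½⟨z, Az⟩ - i⟨γ, z⟩ + ∫ (1 + i⟨z,s⟩ 1_{|s|<1} - e^{i⟨z,s⟩}) ν(ds)` on `ℝ^d`. -/
noncomputable def levyExponent {d : ℕ} (A : Matrix (Fin d) (Fin d) ℝ)
    (γ : EuclideanSpace ℝ (Fin d)) (ν : Measure (EuclideanSpace ℝ (Fin d)))
    (z : EuclideanSpace ℝ (Fin d)) : ℂ :=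
  1 / 2 * ((z.ofLp ⬝ᵥ (A *ᵥ z.ofLp) : ℝ) : ℂ) - Complex.I * ((inner ℝ γ z : ℝ) : ℂ)
    + ∫ s, (1 + Complex.I * ((if ‖s‖ < 1 then inner ℝ z s else 0 : ℝ) : ℂ)
        - Complex.exp (Complex.I * ((inner ℝ z s : ℝ) : ℂ))) ∂ν

/-- The integrability condition `∫ min(|s|², 1) ν(ds) < ∞` on a jump measure. -/
def IsJumpMeasure {d : ℕ} (ν : Measure (EuclideanSpace ℝ (Fin d))) : Prop :=
  ∫⁻ s, ENNReal.ofReal (min (‖s‖ ^ 2) 1) ∂ν < ∞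

/-! ### Lévy processes -/

/-- `X = (X_t)_{t ≥ 0}` is a Lévy process on `ℝ^d`: stationary and independent increments,
`X_0 = 0` almost surely, and stochastic continuity. -/
structure IsLevyProcess {Ω : Type*} [MeasurableSpace Ω] {d : ℕ}
    (X : ℝ≥0 → Ω → EuclideanSpace ℝ (Fin d)) (P : Measure Ω) : Prop where
  measurable : ∀ t, Measurable (X t)
  stationary : ∀ s t, IdentDistrib (fun ω => X (t + s) ω - X t ω) (X s) P P
  indep : HasIndepIncrements X P
  start_zero : ∀ᵐ ω ∂P, X 0 ω = 0
  stoch_cont : ∀ η : ℝ, 0 < η →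
    Filter.Tendsto (fun t => P {ω | η < ‖X t ω‖}) (nhdsWithin 0 (Set.Ioi 0)) (nhds 0)

/-- `f` is the characteristic exponent of `X`: `𝔼 exp(i⟨X_t, z⟩) = exp(-t f(z))`. -/
def HasCharExponent {Ω : Type*} [MeasurableSpace Ω] {d : ℕ}
    (X : ℝ≥0 → Ω → EuclideanSpace ℝ (Fin d)) (P : Measure Ω)
    (f : EuclideanSpace ℝ (Fin d) → ℂ) : Prop :=
  ∀ (t : ℝ≥0) (z : EuclideanSpace ℝ (Fin d)),
    ∫ ω, Complex.exp (Complex.I * ((inner ℝ (X t ω) z : ℝ) : ℂ)) ∂P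
      = Complex.exp (-((t : ℝ) : ℂ) * f z)

/-- `(X^{(v,j)})`, for elements `v ∈ [n]` and indices `j ∈ [m]`, are i.i.d. copies of the Lévy
process with characteristic exponent `f`: each is a Lévy process with exponent `f` (which
determines its law), and as random paths they are mutually independent. -/
structure IsLevyCopies {Ω : Type*} [MeasurableSpace Ω] {d n m : ℕ}
    (X : Fin n → Fin m → ℝ≥0 → Ω → EuclideanSpace ℝ (Fin d)) (P : Measure Ω)
    (f : EuclideanSpace ℝ (Fin d) → ℂ) : Prop where
  levy : ∀ v j, IsLevyProcess (X v j) P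
  exponent : ∀ v j, HasCharExponent (X v j) P f
  indep : iIndepFun (fun (p : Fin n × Fin m) (ω : Ω) (t : ℝ≥0) => X p.1 p.2 t ω) P

/-! ### Turnstile streams and sketches -/

/-- The frequency vector of a stream of updates `(v, y)`: it starts at zero, and the update
`(v, y)` performs `x(v) ← x(v) + y`. -/
def frequency {n : ℕ} {E : Type*} [AddCommMonoid E] (σ : List (Fin n × E)) : Fin n → E :=
  σ.foldl (fun x u => Function.update x u.1 (x u.1 + u.2)) 0

/-- The `f`-moment `f(x) = ∑_v f(x(v))`. -/
def fMoment {n : ℕ} {E : Type*} (f : E → ℂ) (x : Fin n → E) : ℂ := ∑ v, f (x v)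

/-- A sketch for streams with updates in `U`. Its memory consists of one word, an element of
`W`, for every register in `ι`. The random oracle `ω : Ω` can be evaluated by updates at no cost
in memory, whereas merging and querying use only the memory contents. -/
structure Sketch (Ω U ι W : Type*) where
  init : ι → W
  update : Ω → U → (ι → W) → (ι → W)
  merge : (ι → W) → (ι → W) → (ι → W)
  query : (ι → W) → ℂ

namespace Sketch

variable {Ω U ι W : Type*}

/-- The memory after processing the stream `σ`. -/
def run (S : Sketch Ω U ι W) (ω : Ω) (σ : List U) : ι → W :=
  σ.foldl (fun s u => S.update ω u s) S.init

/-- The estimate returned after processing the stream `σ`. -/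
def output (S : Sketch Ω U ι W) (ω : Ω) (σ : List U) : ℂ := S.query (S.run ω σ)

/-- From the memories for two streams, one obtains the memory for their concatenation. -/
def Mergeable (S : Sketch Ω U ι W) : Prop :=
  ∀ ω σ τ, S.merge (S.run ω σ) (S.run ω τ) = S.run ω (σ ++ τ)

/-- The number of words of memory. -/
def words [Fintype ι] (_S : Sketch Ω U ι W) : ℕ := Fintype.card ι

end Sketch

/-! ### The Lévy-Tower -/

/-- Scan the levels `k = K, K-1, …, 0` in decreasing order; at the first level with
`|1 - Y_k| > 0.2` return `-2^k log Y_k` (principal branch). If there is none, return `0`. -/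
noncomputable def scanLevels : (K : ℕ) → (Fin (K + 1) → ℂ) → ℂ
  | 0, Y => if 0.2 < ‖1 - Y 0‖ then -Complex.log (Y 0) else 0
  | K + 1, Y =>
      if 0.2 < ‖1 - Y (Fin.last (K + 1))‖ then
        -2 ^ (K + 1) * Complex.log (Y (Fin.last (K + 1)))
      else scanLevels K (fun k => Y k.castSucc)

/-- The estimator applied to the points `c (k, j) = e^{i S_k^{(j)}}` of the unit circle:
scan the levels with the empirical means `Y_k = (1/m) ∑_j e^{i S_k^{(j)}}`. -/
noncomputable def towerEstimate {m K : ℕ} (c : Fin (K + 1) × Fin m → Circle) : ℂ :=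
  scanLevels K (fun k => 1 / (m : ℂ) * ∑ j, (c (k, j) : ℂ))

/-- The projection `⟨y, X_{2^{-k}}^{(v,j)}⟩` of an update `u = (v, y)`. -/
noncomputable def projection {Ω : Type*} {d n m : ℕ}
    (X : Fin n → Fin m → ℝ≥0 → Ω → EuclideanSpace ℝ (Fin d)) (ω : Ω)
    (u : Fin n × EuclideanSpace ℝ (Fin d)) (k : ℕ) (j : Fin m) : ℝ :=
  inner ℝ u.2 (X u.1 j ((2 ^ k)⁻¹) ω)

/-- The Lévy-Tower with levels `0, …, K` and `m` copies. The register `S_k^{(j)}` holds a number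
modulo `2π`, starts at zero, and the update `(v, y)` adds `⟨y, X_{2^{-k}}^{(v,j)}⟩ mod 2π`. -/
noncomputable def levyTower {Ω : Type*} {d n m : ℕ}
    (X : Fin n → Fin m → ℝ≥0 → Ω → EuclideanSpace ℝ (Fin d)) (K : ℕ) :
    Sketch Ω (Fin n × EuclideanSpace ℝ (Fin d)) (Fin (K + 1) × Fin m) Real.Angle where
  init := fun _ => 0
  update := fun ω u S p => S p + ((projection X ω u p.1 p.2 : ℝ) : Real.Angle)
  merge := fun S T p => S p + T p
  query := fun S => towerEstimate (fun p => (S p).toCircle)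

/-- The Lévy-Tower with words of `b` bits: a register holds `s ∈ ℤ/2^b`, which represents the
angle `2π s / 2^b`, and the projections are rounded to the nearest multiple of `2π / 2^b`. -/
noncomputable def levyTowerBits {Ω : Type*} {d n m : ℕ}
    (X : Fin n → Fin m → ℝ≥0 → Ω → EuclideanSpace ℝ (Fin d)) (K b : ℕ) :
    Sketch Ω (Fin n × EuclideanSpace ℝ (Fin d)) (Fin (K + 1) × Fin m) (ZMod (2 ^ b)) where
  init := fun _ => 0
  update := fun ω u S p =>
    S p + ((round (projection X ω u p.1 p.2 * 2 ^ b / (2 * Real.pi)) : ℤ) : ZMod (2 ^ b))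
  merge := fun S T p => S p + T p
  query := fun S => towerEstimate (fun p => ZMod.toCircle (S p))

end LevySketch

open LevySketch

/-! Write `F` for the moment of the frequency vector `x` and `w = 2⁻ᵏ F`. A level-`k` register
holds, modulo `2π`, the sum over `v` of `⟨x(v), X_{2⁻ᵏ}⟩`. By independence over `v`, the mean of its
image on the circle is `∏ᵥ exp(-2⁻ᵏ f(x(v))) = exp(-w)`. Hence `-2ᵏ log Y_k` estimates `F` well when
`‖w‖ ≤ 1`, so that the principal branch is the right one, and `‖w‖` is bounded below, so that the
factor `2ᵏ` is `O(‖F‖)`. The downward scan stops at such a level: a rejected level forces `‖w‖ ≤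
1/2`, so the next one still has `‖w‖ ≤ 1`, and an accepted level forces `‖w‖ ≥ 1/10`
(`norm_scanLevels_sub_le`).

All levels with `‖F‖ ≤ 2ᵏ` have to be accurate at once, at a cost independent of `K`. The variance
of `Y_k` is `(1 - ‖exp(-w)‖²)/m ≤ 2‖w‖/m`, so Chebyshev failure probabilities decay geometrically in
`k` and a union bound suffices (`tower_levels_close`). The levels share paths, but no independence
between them is needed. Rounding is a further deterministic error of at most `π/2ᵇ` per update.

Existence of the processes rests on characteristic functions. For a finite jump measure, `exp(-f)`
belongs to a Gaussian convolved with a compound Poisson law; the general case follows by cutting off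
small jumps and Lévy's continuity theorem. Summation by parts, formally `∑ ⟨X_t, θ_t⟩ = ∫ ⟨tailSum u
θ, dX_u⟩`, predicts the joint characteristic function `exp(-∫₀^∞ f(tailSum u θ) du)`. Laws with this
transform are built by appending independent increments. They are consistent because the transform
determines them, and Kolmogorov's theorem glues them (`exists_hasLevyLaws`). The same formula yields
stationarity and independence of increments (`isLevyProcess_of_joint`). -/

namespace LevySketch

/-! ### Deterministic analysis of the level scan. -/

section Estimator

/-- Second-order Taylor bound for the exponential on the unit disc. -/
lemma norm_exp_sub_one_sub_le {w : ℂ} (hw : ‖w‖ ≤ 1) :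
    ‖Complex.exp w - 1 - w‖ ≤ 3 / 4 * ‖w‖ ^ 2 := by
  have h := Complex.exp_bound hw (n := 2) (by norm_num)
  simp only [Finset.sum_range_succ, Finset.sum_range_zero, Nat.factorial] at h
  have e : Complex.exp w - 1 - w = Complex.exp w - (0 + w ^ 0 / ((1 : ℕ) : ℂ)
      + w ^ 1 / (((0 + 1) * 1 : ℕ) : ℂ)) := by
    push_cast; ring
  rw [e]
  refine h.trans (le_of_eq ?_)
  push_cast; ring

lemma norm_one_sub_exp_neg_le {w : ℂ} (hw : ‖w‖ ≤ 1) :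
    ‖1 - Complex.exp (-w)‖ ≤ 7 / 4 * ‖w‖ := by
  have h := norm_exp_sub_one_sub_le (w := -w) (by simpa using hw)
  rw [norm_neg] at h
  have e : 1 - Complex.exp (-w) = w - (Complex.exp (-w) - 1 - -w) := by ring
  rw [e]
  refine (norm_sub_le _ _).trans ?_
  nlinarith [norm_nonneg w]

lemma le_norm_one_sub_exp_neg {w : ℂ} (hw : ‖w‖ ≤ 1) :
    ‖w‖ - 3 / 4 * ‖w‖ ^ 2 ≤ ‖1 - Complex.exp (-w)‖ := by
  have h := norm_exp_sub_one_sub_le (w := -w) (by simpa using hw)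
  rw [norm_neg] at h
  have h2 : ‖w‖ ≤ ‖1 - Complex.exp (-w)‖ + ‖Complex.exp (-w) - 1 - -w‖ := by
    refine le_trans (le_of_eq ?_) (norm_add_le _ _)
    congr 1; ring
  linarith

/-- The principal logarithm is stable near `exp (-w)` for `w` in the unit disc. -/
lemma norm_log_add_le {w y : ℂ} {δ : ℝ} (hw : ‖w‖ ≤ 1) (hδ : δ ≤ 1 / 40)
    (hy : ‖y - Complex.exp (-w)‖ ≤ δ) : ‖Complex.log y + w‖ ≤ 9 / 2 * δ := by
  set u := y * Complex.exp w - 1 with hu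
  have hδ0 : 0 ≤ δ := (norm_nonneg _).trans hy
  have hexp : ‖Complex.exp w‖ ≤ 3 := by
    refine (Complex.norm_exp_le_exp_norm w).trans ?_
    refine (Real.exp_le_exp.2 hw).trans ?_
    exact Real.exp_one_lt_three.le
  have hun : ‖u‖ ≤ 3 * δ := by
    have e : u = (y - Complex.exp (-w)) * Complex.exp w := by
      rw [sub_mul, ← Complex.exp_add]; simp [hu]
    rw [e, norm_mul]
    nlinarith [norm_nonneg (Complex.exp w), norm_nonneg (y - Complex.exp (-w))]
  have hl : ‖Complex.log (1 + u)‖ ≤ 3 / 2 * ‖u‖ :=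
    Complex.norm_log_one_add_half_le_self (by linarith)
  have hy' : y = Complex.exp (-w + Complex.log (1 + u)) := by
    have h1u : 1 + u ≠ 0 := by
      intro h0
      have : u = -1 := by linear_combination h0
      rw [this] at hun; simp at hun; linarith
    rw [Complex.exp_add, Complex.exp_log h1u, hu]
    rw [add_sub_cancel, mul_comm y, ← mul_assoc, ← Complex.exp_add]; simp
  -- Since `‖w‖ ≤ 1` and `‖log (1 + u)‖ ≤ 3/2 · 3/40`, the imaginary part stays inside `(-π, π)`, so
  -- the principal logarithm inverts the exponential here.
  have him : |(-w + Complex.log (1 + u)).im| < 3 := by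
    refine (Complex.abs_im_le_norm _).trans_lt ?_
    refine (norm_add_le _ _).trans_lt ?_
    rw [norm_neg]; linarith
  have hpi := Real.pi_gt_three
  rw [abs_lt] at him
  have hlog : Complex.log y = -w + Complex.log (1 + u) := by
    rw [hy']
    exact Complex.log_exp (by linarith) (by linarith)
  rw [hlog]
  have : -w + Complex.log (1 + u) + w = Complex.log (1 + u) := by ring
  rw [this]; linarith

/-- If all the levels `k` with `‖F‖ ≤ 2 ^ k` are `δ`-close to `exp (-2⁻ᵏ F)`, then scanning
the levels recovers `F` up to a relative error `60 δ`. -/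
lemma norm_scanLevels_sub_le {F : ℂ} (hF : 1 ≤ ‖F‖) {δ : ℝ} (hδ : δ ≤ 1 / 40) :
    ∀ (K : ℕ) (Y : Fin (K + 1) → ℂ), ‖F‖ ≤ 2 ^ K →
      (∀ k : Fin (K + 1), ‖F‖ ≤ 2 ^ (k : ℕ) →
        ‖Y k - Complex.exp (-((2 ^ (k : ℕ))⁻¹ * F))‖ ≤ δ) →
      ‖scanLevels K Y - F‖ ≤ 60 * δ * ‖F‖ := by
  have halt : ∀ (k : ℕ) (y : ℂ), ‖F‖ ≤ 2 ^ k →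
      ‖y - Complex.exp (-((2 ^ k)⁻¹ * F))‖ ≤ δ → 0.2 < ‖1 - y‖ →
      ‖-2 ^ k * Complex.log y - F‖ ≤ 60 * δ * ‖F‖ := by
    intro k y hk hy h1
    set w : ℂ := (2 ^ k)⁻¹ * F with hw
    have hp : (0 : ℝ) < 2 ^ k := by positivity
    have hwn : ‖w‖ = ‖F‖ / 2 ^ k := by
      rw [hw, norm_mul, norm_inv, norm_pow]; simp; ring
    have hw1 : ‖w‖ ≤ 1 := by rw [hwn]; exact (div_le_one hp).2 hk
    have h2 : ‖1 - y‖ ≤ ‖1 - Complex.exp (-w)‖ + δ := by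
      have e : 1 - y = (1 - Complex.exp (-w)) - (y - Complex.exp (-w)) := by ring
      rw [e]; exact (norm_sub_le _ _).trans (by linarith)
    have h3 := norm_one_sub_exp_neg_le hw1
    -- From `0.2 < 7/4 ‖w‖ + 1/40`. The error is then at most `10 · 9/2 = 45` times `δ ‖F‖`.
    have h4 : 1 / 10 ≤ ‖w‖ := by norm_num at h1; linarith
    have h5 : (2 : ℝ) ^ k ≤ 10 * ‖F‖ := by
      rw [hwn, le_div_iff₀ hp] at h4; linarith
    have h6 := norm_log_add_le hw1 hδ hy
    have hFw : F = 2 ^ k * w := by rw [hw]; field_simp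
    have e : -2 ^ k * Complex.log y - F = -(2 ^ k * (Complex.log y + w)) := by
      nth_rewrite 1 [hFw]; ring
    have hδ0 : 0 ≤ δ := (norm_nonneg _).trans hy
    rw [e, norm_neg, norm_mul, norm_pow, Complex.norm_ofNat]
    calc (2 : ℝ) ^ k * ‖Complex.log y + w‖ ≤ (10 * ‖F‖) * (9 / 2 * δ) := by gcongr
      _ ≤ 60 * δ * ‖F‖ := by nlinarith [mul_nonneg hδ0 (norm_nonneg F)]
  have descend : ∀ (k : ℕ) (y : ℂ), ‖F‖ ≤ 2 ^ k →
      ‖y - Complex.exp (-((2 ^ k)⁻¹ * F))‖ ≤ δ → ¬ 0.2 < ‖1 - y‖ → ‖F‖ ≤ 2 ^ k / 2 := by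
    intro k y hk hy h1
    set w : ℂ := (2 ^ k)⁻¹ * F with hw
    have hp : (0 : ℝ) < 2 ^ k := by positivity
    have hwn : ‖w‖ = ‖F‖ / 2 ^ k := by
      rw [hw, norm_mul, norm_inv, norm_pow]; simp; ring
    have hw1 : ‖w‖ ≤ 1 := by rw [hwn]; exact (div_le_one hp).2 hk
    have h2 : ‖1 - Complex.exp (-w)‖ ≤ ‖1 - y‖ + δ := by
      have e : 1 - Complex.exp (-w) = (1 - y) + (y - Complex.exp (-w)) := by ring
      rw [e]; exact (norm_add_le _ _).trans (by linarith)
    have h3 := le_norm_one_sub_exp_neg hw1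
    -- On `[1/2, 1]` the concave function `r - 3/4 r²` is at least its endpoint value `1/4`, which
    -- exceeds `0.2 + 1/40`.
    have h4 : ‖w‖ ≤ 1 / 2 := by
      norm_num at h1
      by_contra! h
      nlinarith
    rw [hwn, div_le_iff₀ hp] at h4; linarith
  intro K
  induction K with
  | zero =>
    intro Y hK hY
    have h0 := hY 0 (by simpa using hK)
    rw [scanLevels]
    split_ifs with h
    · have := halt 0 (Y 0) hK h0 h
      simpa using this
    -- Rejection at level `0` would give `‖F‖ ≤ 1/2`, so the default value `0` is never returned.
    · have := descend 0 (Y 0) hK h0 h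
      norm_num at this; linarith
  | succ K ih =>
    intro Y hK hY
    have h0 := hY (Fin.last (K + 1)) (by simpa using hK)
    rw [Fin.val_last] at h0
    rw [scanLevels]
    split_ifs with h
    · exact halt (K + 1) _ hK h0 h
    · have := descend (K + 1) _ hK h0 h
      refine ih _ (by rw [pow_succ] at this; linarith) (fun k hk => hY k.castSucc hk)

end Estimator

/-! ### Linearity of the registers, mergeability and rounding. -/

section Registers

variable {Ω : Type*} {d n m : ℕ}

/-- The inner product of the frequency vector with the copies `X^{(v,j)}` at time `2⁻ᵏ`. -/
noncomputable def pairing (X : Fin n → Fin m → ℝ≥0 → Ω → EuclideanSpace ℝ (Fin d)) (ω : Ω)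
    (x : Fin n → EuclideanSpace ℝ (Fin d)) (k : ℕ) (j : Fin m) : ℝ :=
  ∑ v, inner ℝ (x v) (X v j ((2 ^ k)⁻¹) ω)

lemma frequency_concat {E : Type*} [AddCommMonoid E] (σ : List (Fin n × E)) (u : Fin n × E) :
    frequency (σ ++ [u]) = Function.update (frequency σ) u.1 (frequency σ u.1 + u.2) := by
  simp [frequency, List.foldl_append]

/-- Additivity of the inner product: the accumulated projections depend on the stream only through
its frequency vector. -/
lemma pairing_frequency (X : Fin n → Fin m → ℝ≥0 → Ω → EuclideanSpace ℝ (Fin d)) (ω : Ω)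
    (σ : List (Fin n × EuclideanSpace ℝ (Fin d))) (k : ℕ) (j : Fin m) :
    pairing X ω (frequency σ) k j = (σ.map fun u => projection X ω u k j).sum := by
  induction σ using List.reverseRecOn with
  | nil => simp [pairing, frequency]
  | append_singleton σ u ih =>
    rw [frequency_concat, List.map_append, List.sum_append, ← ih, pairing, pairing,
      ← Finset.add_sum_erase _ _ (Finset.mem_univ u.1),
      ← Finset.add_sum_erase (a := u.1) _ (fun v => inner ℝ (frequency σ v) _) (Finset.mem_univ _)]
    rw [Function.update_self, inner_add_left]
    have : ∑ v ∈ Finset.univ.erase u.1, inner ℝ (Function.update (frequency σ) u.1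
        (frequency σ u.1 + u.2) v) (X v j ((2 ^ k)⁻¹) ω)
        = ∑ v ∈ Finset.univ.erase u.1, inner ℝ (frequency σ v) (X v j ((2 ^ k)⁻¹) ω) := by
      refine Finset.sum_congr rfl fun v hv => ?_
      rw [Function.update_of_ne (Finset.ne_of_mem_erase hv)]
    rw [this]
    simp [projection]; ring

/-- A sketch whose registers add up increments that depend only on the update. -/
lemma run_eq_sum {U ι W : Type*} [AddCommMonoid W] (S : Sketch Ω U ι W) (g : Ω → U → ι → W)
    (h0 : S.init = 0) (hu : ∀ ω u s, S.update ω u s = s + g ω u) (ω : Ω) (σ : List U) :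
    S.run ω σ = (σ.map (g ω)).sum := by
  induction σ using List.reverseRecOn with
  | nil => simp [Sketch.run, h0]
  | append_singleton σ u ih =>
    rw [List.map_append, List.sum_append, ← ih]
    simp [Sketch.run, List.foldl_append, hu]

/-- The memory is a sum over the stream, and concatenation of streams adds such sums. -/
lemma mergeable_of_add {U ι W : Type*} [AddCommMonoid W] (S : Sketch Ω U ι W) (g : Ω → U → ι → W)
    (h0 : S.init = 0) (hu : ∀ ω u s, S.update ω u s = s + g ω u)
    (hm : ∀ s t, S.merge s t = s + t) : S.Mergeable := by
  intro ω σ τ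
  rw [hm, run_eq_sum S g h0 hu, run_eq_sum S g h0 hu, run_eq_sum S g h0 hu, List.map_append,
    List.sum_append]

lemma levyTower_mergeable (X : Fin n → Fin m → ℝ≥0 → Ω → EuclideanSpace ℝ (Fin d)) (K : ℕ) :
    (levyTower X K).Mergeable :=
  mergeable_of_add _ (fun ω u p => ((projection X ω u p.1 p.2 : ℝ) : Real.Angle)) rfl
    (fun _ _ _ => rfl) (fun _ _ => rfl)

lemma levyTowerBits_mergeable (X : Fin n → Fin m → ℝ≥0 → Ω → EuclideanSpace ℝ (Fin d))
    (K b : ℕ) : (levyTowerBits X K b).Mergeable :=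
  mergeable_of_add _ (fun ω u p =>
    ((round (projection X ω u p.1 p.2 * 2 ^ b / (2 * Real.pi)) : ℤ) : ZMod (2 ^ b))) rfl
    (fun _ _ _ => rfl) (fun _ _ => rfl)

lemma levyTower_run_toCircle (X : Fin n → Fin m → ℝ≥0 → Ω → EuclideanSpace ℝ (Fin d)) (K : ℕ)
    (ω : Ω) (σ : List (Fin n × EuclideanSpace ℝ (Fin d))) (p : Fin (K + 1) × Fin m) :
    (((levyTower X K).run ω σ p).toCircle : ℂ)
      = Complex.exp (pairing X ω (frequency σ) p.1 p.2 * Complex.I) := by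
  have h : (levyTower X K).run ω σ p
      = ((pairing X ω (frequency σ) p.1 p.2 : ℝ) : Real.Angle) := by
    rw [run_eq_sum _ (fun ω u p => ((projection X ω u p.1 p.2 : ℝ) : Real.Angle)) rfl
      (fun _ _ _ => rfl), pairing_frequency]
    induction σ with
    | nil => simp
    | cons u σ ih =>
      simp only [List.map_cons, List.sum_cons, Pi.add_apply, Real.Angle.coe_add, ih]
  rw [h, Real.Angle.toCircle_coe, Circle.coe_exp]

lemma norm_exp_mul_I_sub_le (x y : ℝ) :
    ‖Complex.exp (x * Complex.I) - Complex.exp (y * Complex.I)‖ ≤ |x - y| := by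
  have e : Complex.exp (x * Complex.I) - Complex.exp (y * Complex.I)
      = Complex.exp (y * Complex.I) * (Complex.exp (Complex.I * ((x - y : ℝ) : ℂ)) - 1) := by
    rw [mul_sub, ← Complex.exp_add]
    push_cast
    ring_nf
  rw [e, norm_mul, Complex.norm_exp_ofReal_mul_I, one_mul]
  exact Real.norm_exp_I_mul_ofReal_sub_one_le

/-- Rounding every projection to a multiple of `2π / 2ᵇ` moves each register by at most
`π / 2ᵇ` per update. -/
lemma levyTowerBits_run_toCircle (X : Fin n → Fin m → ℝ≥0 → Ω → EuclideanSpace ℝ (Fin d))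
    (K b : ℕ) (ω : Ω) (σ : List (Fin n × EuclideanSpace ℝ (Fin d))) (p : Fin (K + 1) × Fin m) :
    ‖(ZMod.toCircle ((levyTowerBits X K b).run ω σ p) : ℂ)
      - Complex.exp (pairing X ω (frequency σ) p.1 p.2 * Complex.I)‖
      ≤ σ.length * (Real.pi / 2 ^ b) := by
  have h : (levyTowerBits X K b).run ω σ p
      = (((σ.map fun u => round (projection X ω u p.1 p.2 * 2 ^ b / (2 * Real.pi))).sum : ℤ) :
        ZMod (2 ^ b)) := by
    rw [run_eq_sum _ (fun ω u p =>
      ((round (projection X ω u p.1 p.2 * 2 ^ b / (2 * Real.pi)) : ℤ) : ZMod (2 ^ b))) rfl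
      (fun _ _ _ => rfl)]
    induction σ with
    | nil => simp
    | cons u σ ih => simp only [List.map_cons, List.sum_cons, Pi.add_apply, Int.cast_add, ih]
  have h2 : |2 * Real.pi / 2 ^ b * ((σ.map fun u => round (projection X ω u p.1 p.2 * 2 ^ b
      / (2 * Real.pi))).sum : ℤ) - (σ.map fun u => projection X ω u p.1 p.2).sum|
      ≤ σ.length * (Real.pi / 2 ^ b) := by
    clear h
    induction σ with
    | nil => simp
    | cons u σ ih =>
      have hr := abs_sub_round (projection X ω u p.1 p.2 * 2 ^ b / (2 * Real.pi))
      set r := round (projection X ω u p.1 p.2 * 2 ^ b / (2 * Real.pi))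
      set a := projection X ω u p.1 p.2
      have hpi := Real.pi_pos
      -- Rounding moves a point by at most half the grid spacing `2π / 2ᵇ`.
      have hu : |2 * Real.pi / 2 ^ b * r - a| ≤ Real.pi / 2 ^ b := by
        have e : 2 * Real.pi / 2 ^ b * r - a
            = -(2 * Real.pi / 2 ^ b) * (a * 2 ^ b / (2 * Real.pi) - r) := by
          field_simp; ring
        rw [e, abs_mul, abs_neg, abs_of_pos (by positivity)]
        calc 2 * Real.pi / 2 ^ b * |a * 2 ^ b / (2 * Real.pi) - r|
            ≤ 2 * Real.pi / 2 ^ b * (1 / 2) := by gcongr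
          _ = Real.pi / 2 ^ b := by ring
      simp only [List.map_cons, List.sum_cons, List.length_cons, Int.cast_add, Nat.cast_add,
        Nat.cast_one]
      set s := (((σ.map fun u => round (projection X ω u p.1 p.2 * 2 ^ b / (2 * Real.pi))).sum :
        ℤ) : ℝ)
      set t := (σ.map fun u => projection X ω u p.1 p.2).sum
      change |2 * Real.pi / 2 ^ b * ((r : ℝ) + s) - (a + t)| ≤ _
      calc _ = |(2 * Real.pi / 2 ^ b * r - a) + (2 * Real.pi / 2 ^ b * s - t)| := by
            congr 1; ring
        _ ≤ _ := (abs_add_le _ _).trans (by linarith)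
  rw [h, ZMod.toCircle_intCast, pairing_frequency]
  refine le_trans (le_of_eq ?_) ((norm_exp_mul_I_sub_le _ _).trans h2)
  congr 3
  generalize (σ.map fun u => round (projection X ω u p.1 p.2 * 2 ^ b / (2 * Real.pi))).sum = s
  push_cast; ring

end Registers

/-! ### Variance of empirical means and the sum of failure probabilities. -/

section Concentration

variable {Ω : Type*} [MeasurableSpace Ω] {P : Measure Ω} [IsProbabilityMeasure P]

/-- The mean square error of the empirical mean of pairwise independent unit complex numbers. -/
lemma integral_norm_mean_sub_sq_le {m : ℕ} (hm : 0 < m) {W : Fin m → Ω → ℂ} {μ : ℂ}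
    (hW : ∀ j, Measurable (W j)) (h1 : ∀ j ω, ‖W j ω‖ = 1)
    (hind : ∀ j l, j ≠ l → IndepFun (W j) (W l) P) (hμ : ∀ j, ∫ ω, W j ω ∂P = μ) :
    ∫ ω, ‖1 / (m : ℂ) * ∑ j, W j ω - μ‖ ^ 2 ∂P = (1 - ‖μ‖ ^ 2) / m := by
  have hm' : (m : ℂ) ≠ 0 := by exact_mod_cast hm.ne'
  have hWint : ∀ j, Integrable (W j) P := fun j =>
    Integrable.of_bound (hW j).aestronglyMeasurable 1 (by simp [h1])
  let V : Fin m → Ω → ℂ := fun j ω => W j ω - μ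
  have hV : ∀ j, Measurable (V j) := fun j => (hW j).sub_const μ
  have hVb : ∀ j ω, ‖V j ω‖ ≤ 1 + ‖μ‖ := fun j ω =>
    (norm_sub_le _ _).trans (by rw [h1])
  have hVmean : ∀ j, ∫ ω, V j ω ∂P = 0 := by
    intro j
    simp only [V]
    rw [integral_sub (hWint j) (integrable_const _), hμ]; simp
  have hint : ∀ j l, Integrable (fun ω => V j ω * (starRingEnd ℂ) (V l ω)) P := by
    intro j l
    refine Integrable.of_bound (C := (1 + ‖μ‖) * (1 + ‖μ‖)) ?_ ?_
    · exact ((hV j).mul (Complex.continuous_conj.measurable.comp (hV l))).aestronglyMeasurable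
    · refine Filter.Eventually.of_forall fun ω => ?_
      rw [norm_mul, RCLike.norm_conj]
      gcongr
      · exact hVb j ω
      · exact hVb l ω
  have hoff : ∀ j l, j ≠ l → ∫ ω, V j ω * (starRingEnd ℂ) (V l ω) ∂P = 0 := by
    intro j l hjl
    have hI : IndepFun (V j) (fun ω => (starRingEnd ℂ) (V l ω)) P :=
      (hind j l hjl).comp (φ := fun z => z - μ) (ψ := fun z => (starRingEnd ℂ) (z - μ))
        (measurable_id.sub_const μ)
        (Complex.continuous_conj.measurable.comp (measurable_id.sub_const μ))
    rw [hI.integral_fun_mul_eq_mul_integral (hV j).aestronglyMeasurable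
      (Complex.continuous_conj.measurable.comp (hV l)).aestronglyMeasurable, hVmean, zero_mul]
  have hdiag : ∀ j, ∫ ω, V j ω * (starRingEnd ℂ) (V j ω) ∂P = 1 - μ * (starRingEnd ℂ) μ := by
    intro j
    have e : ∀ ω, V j ω * (starRingEnd ℂ) (V j ω)
        = 1 - W j ω * (starRingEnd ℂ) μ - μ * (starRingEnd ℂ) (W j ω)
          + μ * (starRingEnd ℂ) μ := by
      intro ω
      have hw : W j ω * (starRingEnd ℂ) (W j ω) = 1 := by
        rw [Complex.mul_conj, Complex.normSq_eq_norm_sq, h1]; simp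
      simp only [V, map_sub]
      linear_combination hw
    simp_rw [e]
    have i1 : Integrable (fun ω => W j ω * (starRingEnd ℂ) μ) P := (hWint j).mul_const _
    have i2' : Integrable (fun ω => (starRingEnd ℂ) (W j ω)) P :=
      Integrable.of_bound (Complex.continuous_conj.measurable.comp (hW j)).aestronglyMeasurable 1
        (by simp [h1])
    have i2 : Integrable (fun ω => μ * (starRingEnd ℂ) (W j ω)) P := i2'.const_mul _
    have i3 : Integrable (fun ω => 1 - W j ω * (starRingEnd ℂ) μ) P := (integrable_const _).sub i1
    have i4 : Integrable (fun ω => 1 - W j ω * (starRingEnd ℂ) μ - μ * (starRingEnd ℂ) (W j ω)) P :=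
      i3.sub i2
    rw [integral_add i4 (integrable_const _), integral_sub i3 i2,
      integral_sub (integrable_const _) i1,
      integral_mul_const, integral_const_mul, integral_conj, hμ]
    simp
  have hsq : ∀ ω, ((‖1 / (m : ℂ) * ∑ j, W j ω - μ‖ ^ 2 : ℝ) : ℂ)
      = (1 / (m : ℂ) ^ 2) * ∑ j, ∑ l, V j ω * (starRingEnd ℂ) (V l ω) := by
    intro ω
    have e : 1 / (m : ℂ) * ∑ j, W j ω - μ = 1 / (m : ℂ) * ∑ j, V j ω := by
      simp only [V, Finset.sum_sub_distrib, Finset.sum_const, Finset.card_univ, Fintype.card_fin,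
        nsmul_eq_mul]
      field_simp
    rw [e, ← Complex.normSq_eq_norm_sq, ← Complex.mul_conj, map_mul, map_sum, mul_mul_mul_comm,
      Finset.sum_mul_sum]
    rw [map_div₀, map_one, Complex.conj_natCast]
    congr 1; ring
  have key : ((∫ ω, ‖1 / (m : ℂ) * ∑ j, W j ω - μ‖ ^ 2 ∂P : ℝ) : ℂ)
      = (((1 - ‖μ‖ ^ 2) / m : ℝ) : ℂ) := by
    rw [← integral_complex_ofReal]
    simp_rw [hsq]
    rw [integral_const_mul, integral_finsetSum _ (fun j _ => integrable_finsetSum _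
      (fun l _ => hint j l))]
    have : ∀ j, ∫ ω, ∑ l, V j ω * (starRingEnd ℂ) (V l ω) ∂P = 1 - μ * (starRingEnd ℂ) μ := by
      intro j
      rw [integral_finsetSum _ (fun l _ => hint j l), Finset.sum_eq_single j, hdiag]
      · intro l _ hl; exact hoff j l hl.symm
      · simp
    simp_rw [this]
    rw [Complex.mul_conj, Complex.normSq_eq_norm_sq]
    simp only [Finset.sum_const, Finset.card_univ, Fintype.card_fin, nsmul_eq_mul]
    push_cast
    field_simp
  exact_mod_cast key

/-- Chebyshev's inequality. The factor `‖w‖`, absent from the trivial variance bound `1/m`, makes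
the failure probabilities summable over the levels. -/
lemma measureReal_norm_mean_sub_le {m : ℕ} (hm : 0 < m) {W : Fin m → Ω → ℂ} {w : ℂ}
    (hW : ∀ j, Measurable (W j)) (h1 : ∀ j ω, ‖W j ω‖ = 1)
    (hind : ∀ j l, j ≠ l → IndepFun (W j) (W l) P)
    (hμ : ∀ j, ∫ ω, W j ω ∂P = Complex.exp (-w)) {δ : ℝ} (hδ : 0 < δ) :
    P.real {ω | ¬ ‖1 / (m : ℂ) * ∑ j, W j ω - Complex.exp (-w)‖ ≤ δ}
      ≤ 2 * ‖w‖ / (m * δ ^ 2) := by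
  have hI := integral_norm_mean_sub_sq_le hm hW h1 hind hμ
  have hmeas : Measurable fun ω => 1 / (m : ℂ) * ∑ j, W j ω - Complex.exp (-w) :=
    ((Finset.measurable_sum _ fun j _ => hW j).const_mul _).sub_const _
  have hint : Integrable (fun ω => ‖1 / (m : ℂ) * ∑ j, W j ω - Complex.exp (-w)‖ ^ 2) P := by
    refine Integrable.of_bound (hmeas.norm.pow_const 2).aestronglyMeasurable
      ((1 + ‖Complex.exp (-w)‖) ^ 2) (Filter.Eventually.of_forall fun ω => ?_)
    rw [norm_pow, norm_norm]
    gcongr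
    refine (norm_sub_le _ _).trans ?_
    gcongr
    rw [norm_mul, norm_div, norm_one, Complex.norm_natCast]
    have : ‖∑ j, W j ω‖ ≤ m := by
      refine (norm_sum_le _ _).trans ?_
      simp [h1]
    have hm' : (0 : ℝ) < m := by exact_mod_cast hm
    rw [one_div, inv_mul_le_iff₀ hm']; linarith
  have hM := mul_meas_ge_le_integral_of_nonneg (μ := P)
    (f := fun ω => ‖1 / (m : ℂ) * ∑ j, W j ω - Complex.exp (-w)‖ ^ 2)
    (Filter.Eventually.of_forall fun ω => by positivity) hint (δ ^ 2)
  rw [hI] at hM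
  have hsub : P.real {ω | ¬ ‖1 / (m : ℂ) * ∑ j, W j ω - Complex.exp (-w)‖ ≤ δ}
      ≤ P.real {ω | δ ^ 2 ≤ ‖1 / (m : ℂ) * ∑ j, W j ω - Complex.exp (-w)‖ ^ 2} := by
    refine measureReal_mono fun ω hω => ?_
    simp only [Set.mem_ofPred_eq, not_le] at hω ⊢
    gcongr
  -- Here `‖exp(-w)‖² = exp(-2 Re w) ≥ 1 - 2 Re w`.
  have hvar : 1 - ‖Complex.exp (-w)‖ ^ 2 ≤ 2 * ‖w‖ := by
    rw [Complex.norm_exp, ← Real.exp_nat_mul]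
    have h := Real.add_one_le_exp ((2 : ℕ) * (-w).re)
    have h2 := Complex.re_le_norm w
    simp only [Complex.neg_re] at h ⊢
    push_cast at h ⊢
    linarith
  have hm' : (0 : ℝ) < m := by exact_mod_cast hm
  rw [le_div_iff₀ (by positivity)]
  calc _ ≤ P.real {ω | δ ^ 2 ≤ ‖1 / (m : ℂ) * ∑ j, W j ω - Complex.exp (-w)‖ ^ 2}
        * (m * δ ^ 2) := by gcongr
    _ = m * (δ ^ 2 * P.real {ω | δ ^ 2 ≤ ‖1 / (m : ℂ) * ∑ j, W j ω - Complex.exp (-w)‖ ^ 2}) := by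
        ring
    _ ≤ m * ((1 - ‖Complex.exp (-w)‖ ^ 2) / m) := by gcongr
    _ = 1 - ‖Complex.exp (-w)‖ ^ 2 := by field_simp
    _ ≤ _ := hvar

/-- A geometric series whose first term is at most `1`, hence with sum at most `2` when `a ≥ 0`.
Subtracting the tail `2a / 2^N` makes the induction close; the maximum with `0` covers the `N` for
which no index has passed the filter yet. -/
lemma sum_filter_div_two_pow_le (a : ℝ) (N : ℕ) :
    ∑ k ∈ Finset.range N with a ≤ 2 ^ k, a / 2 ^ k ≤ max 0 (2 - 2 * a / 2 ^ N) := by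
  induction N with
  | zero => simp
  | succ N ih =>
    rw [Finset.range_add_one, Finset.filter_insert]
    have hp : (0 : ℝ) < 2 ^ N := by positivity
    have e : 2 * a / 2 ^ (N + 1) = a / 2 ^ N := by rw [pow_succ]; field_simp
    have e2 : 2 * a / 2 ^ N = 2 * (a / 2 ^ N) := by ring
    rw [e2] at ih
    rw [e]
    split_ifs with h
    · rw [Finset.sum_insert (by simp)]
      have : a / 2 ^ N ≤ 1 := (div_le_one hp).2 h
      rw [max_eq_right (by linarith)] at ih
      exact le_max_of_le_right (by linarith)
    · have : 1 < a / 2 ^ N := (one_lt_div hp).2 (not_le.1 h)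
      rw [max_eq_left (by linarith)] at ih
      exact le_max_of_le_left ih

end Concentration

/-! ### Simultaneous accuracy of the relevant levels. -/

section Tower

variable {Ω : Type*} [MeasurableSpace Ω] {P : Measure Ω} {d n m : ℕ}
  {X : Fin n → Fin m → ℝ≥0 → Ω → EuclideanSpace ℝ (Fin d)}
  {f : EuclideanSpace ℝ (Fin d) → ℂ}

lemma measurable_pairing (hX : IsLevyCopies X P f) (x : Fin n → EuclideanSpace ℝ (Fin d))
    (k : ℕ) (j : Fin m) : Measurable fun ω => pairing X ω x k j := by
  refine Finset.measurable_sum _ fun v _ => ?_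
  exact Measurable.const_inner ((hX.levy v j).measurable _)

/-- The two pairings read the disjoint blocks `[n] × {j}` and `[n] × {l}` of an independent family.
-/
lemma indepFun_pairing (hX : IsLevyCopies X P f) (x : Fin n → EuclideanSpace ℝ (Fin d))
    (k : ℕ) {j l : Fin m} (hjl : j ≠ l) :
    IndepFun (fun ω => pairing X ω x k j) (fun ω => pairing X ω x k l) P := by
  have h1 : iIndepFun (fun (p : Fin n × Fin m) ω => X p.1 p.2 ((2 ^ k)⁻¹) ω) P :=
    hX.indep.comp (fun _ y => y ((2 ^ k)⁻¹)) (fun _ => measurable_pi_apply _)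
  let S : Fin m → Finset (Fin n × Fin m) := fun j => Finset.univ ×ˢ {j}
  have hS : Disjoint (S j) (S l) := by
    rw [Finset.disjoint_left]
    rintro ⟨v, i⟩ hi hi'
    simp only [S, Finset.mem_product, Finset.mem_univ, Finset.mem_singleton, true_and] at hi hi'
    exact hjl (hi.symm.trans hi')
  have h2 := h1.indepFun_finset (S j) (S l) hS (fun p => (hX.levy p.1 p.2).measurable _)
  let φ : (j : Fin m) → (S j → EuclideanSpace ℝ (Fin d)) → ℝ := fun j y =>
    ∑ v, inner ℝ (x v) (y ⟨(v, j), by simp [S]⟩)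
  have hφ : ∀ j, Measurable (φ j) := fun j => by
    refine Finset.measurable_sum _ fun v _ => ?_
    exact Measurable.const_inner (measurable_pi_apply _)
  exact h2.comp (hφ j) (hφ l)

/-- Independence over `v` turns the expectation of a product into a product, which adds up the
exponents `f (x v)`; this is where the moment enters. -/
lemma integral_exp_pairing (hX : IsLevyCopies X P f) (x : Fin n → EuclideanSpace ℝ (Fin d))
    (k : ℕ) (j : Fin m) :
    ∫ ω, Complex.exp (pairing X ω x k j * Complex.I) ∂P
      = Complex.exp (-((2 ^ k)⁻¹ * fMoment f x)) := by
  have h1 : iIndepFun (fun (v : Fin n) ω => X v j ((2 ^ k)⁻¹) ω) P :=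
    (hX.indep.comp (fun _ y => y ((2 ^ k)⁻¹)) (fun _ => measurable_pi_apply _)).precomp
      (g := fun v => (v, j)) (fun v w h => (Prod.ext_iff.1 h).1)
  have hc : ∀ v, Continuous fun y : EuclideanSpace ℝ (Fin d) =>
      Complex.exp (Complex.I * ((inner ℝ y (x v) : ℝ) : ℂ)) := fun v => by fun_prop
  have e : ∀ ω, Complex.exp (pairing X ω x k j * Complex.I)
      = ∏ v, Complex.exp (Complex.I * ((inner ℝ (X v j ((2 ^ k)⁻¹) ω) (x v) : ℝ) : ℂ)) := by
    intro ω
    rw [← Complex.exp_sum, ← Finset.mul_sum, mul_comm, pairing]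
    push_cast
    simp_rw [real_inner_comm]
  simp_rw [e]
  rw [h1.integral_fun_prod_comp
    (f := fun v y => Complex.exp (Complex.I * ((inner ℝ y (x v) : ℝ) : ℂ)))
    (fun v => ((hX.levy v j).measurable _).aemeasurable)
    (fun v => (hc v).measurable.aestronglyMeasurable)]
  simp_rw [(hX.exponent _ j) _ _]
  rw [← Complex.exp_sum, ← Finset.mul_sum, fMoment]
  congr 1
  push_cast
  ring

variable [IsProbabilityMeasure P]

/-- The levels that matter to the estimator are all close to their expectations. -/
lemma tower_levels_close (hX : IsLevyCopies X P f) (hm : 0 < m)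
    (x : Fin n → EuclideanSpace ℝ (Fin d)) (K : ℕ) {δ : ℝ} (hδ : 0 < δ)
    (hmδ : 400 ≤ m * δ ^ 2) :
    99 / 100 ≤ P {ω | ∀ k : Fin (K + 1), ‖fMoment f x‖ ≤ 2 ^ (k : ℕ) →
      ‖1 / (m : ℂ) * ∑ j, Complex.exp (pairing X ω x k j * Complex.I)
        - Complex.exp (-((2 ^ (k : ℕ))⁻¹ * fMoment f x))‖ ≤ δ} := by
  set F := fMoment f x
  set D : ℕ → Ω → ℂ := fun k ω => 1 / (m : ℂ) * ∑ j, Complex.exp (pairing X ω x k j * Complex.I)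
        - Complex.exp (-((2 ^ k)⁻¹ * F)) with hD
  have hZ : ∀ k j, Measurable fun ω => Complex.exp (pairing X ω x k j * Complex.I) := by
    intro k j
    have := measurable_pairing hX x k j
    fun_prop
  have hDm : ∀ k, Measurable (D k) := fun k =>
    ((Finset.measurable_sum _ fun j _ => hZ k j).const_mul _).sub_const _
  have hS : MeasurableSet {ω | ∀ k : Fin (K + 1), ‖F‖ ≤ 2 ^ (k : ℕ) → ‖D k ω‖ ≤ δ} := by
    rw [Set.ofPred_forall]
    refine MeasurableSet.iInter fun k => ?_
    by_cases h : ‖F‖ ≤ 2 ^ (k : ℕ)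
    · simp only [h, forall_const]
      exact measurableSet_le (hDm k).norm measurable_const
    · simp [h]
  have hbad : ∀ k, P.real {ω | ¬ ‖D k ω‖ ≤ δ} ≤ 2 * (‖F‖ / 2 ^ k) / (m * δ ^ 2) := by
    intro k
    have hn : ‖(2 ^ k)⁻¹ * F‖ = ‖F‖ / 2 ^ k := by simp; ring
    have := measureReal_norm_mean_sub_le (P := P) hm (hZ k)
      (fun j ω => Complex.norm_exp_ofReal_mul_I _)
      (fun j l hjl => (indepFun_pairing hX x k hjl).comp
        (φ := fun t : ℝ => Complex.exp (t * Complex.I))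
        (ψ := fun t : ℝ => Complex.exp (t * Complex.I))
        (Continuous.measurable (by fun_prop)) (Continuous.measurable (by fun_prop)))
      (fun j => integral_exp_pairing hX x k j) hδ
    rw [hn] at this
    exact this
  have hcompl : P.real {ω | ∀ k : Fin (K + 1), ‖F‖ ≤ 2 ^ (k : ℕ) → ‖D k ω‖ ≤ δ}ᶜ
      ≤ 1 / 100 := by
    have hsub : {ω | ∀ k : Fin (K + 1), ‖F‖ ≤ 2 ^ (k : ℕ) → ‖D k ω‖ ≤ δ}ᶜ
        ⊆ ⋃ k ∈ (Finset.range (K + 1)).filter (fun k => ‖F‖ ≤ 2 ^ k), {ω | ¬ ‖D k ω‖ ≤ δ} := by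
      intro ω hω
      simp only [Set.mem_compl_iff, Set.mem_ofPred_eq, not_forall] at hω
      obtain ⟨k, hk, h⟩ := hω
      simp only [Set.mem_iUnion]
      exact ⟨k, Finset.mem_filter.2 ⟨Finset.mem_range.2 k.2, hk⟩, h⟩
    have h0 : 0 < m * δ ^ 2 := by linarith
    calc _ ≤ P.real (⋃ k ∈ (Finset.range (K + 1)).filter (fun k => ‖F‖ ≤ 2 ^ k),
          {ω | ¬ ‖D k ω‖ ≤ δ}) := measureReal_mono hsub (measure_ne_top _ _)
      _ ≤ ∑ k ∈ (Finset.range (K + 1)).filter (fun k => ‖F‖ ≤ 2 ^ k),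
          P.real {ω | ¬ ‖D k ω‖ ≤ δ} := measureReal_biUnion_finset_le _ _
      _ ≤ ∑ k ∈ (Finset.range (K + 1)).filter (fun k => ‖F‖ ≤ 2 ^ k),
          2 * (‖F‖ / 2 ^ k) / (m * δ ^ 2) := Finset.sum_le_sum fun k _ => hbad k
      _ = 2 / (m * δ ^ 2) * ∑ k ∈ Finset.range (K + 1) with ‖F‖ ≤ 2 ^ k, ‖F‖ / 2 ^ k := by
          rw [Finset.mul_sum]
          exact Finset.sum_congr rfl fun k _ => by ring
      -- The geometric sum is at most `2` for every `K`; the threshold `400` for `m δ²` then yields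
      -- `4/400 = 1/100`.
      _ ≤ 2 / (m * δ ^ 2) * 2 := by
          gcongr
          refine (sum_filter_div_two_pow_le _ _).trans (max_le (by norm_num) ?_)
          have : 0 ≤ 2 * ‖F‖ / 2 ^ (K + 1) := by positivity
          linarith
      _ ≤ 2 / 400 * 2 := by gcongr
      _ = 1 / 100 := by norm_num
  rw [probReal_compl_eq_one_sub hS] at hcompl
  have h99 : (99 / 100 : ℝ) ≤ P.real {ω | ∀ k : Fin (K + 1), ‖F‖ ≤ 2 ^ (k : ℕ) →
      ‖D k ω‖ ≤ δ} := by linarith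
  rw [measureReal_def, ← ENNReal.ofReal_le_iff_le_toReal (measure_ne_top _ _)] at h99
  refine le_trans (le_of_eq ?_) h99
  rw [ENNReal.ofReal_div_of_pos (by norm_num)]
  norm_num

/-- The exact tower has relative error `60 δ` with probability at least `99/100`. -/
lemma levyTower_accuracy (hX : IsLevyCopies X P f) (hm : 0 < m) (K : ℕ)
    (σ : List (Fin n × EuclideanSpace ℝ (Fin d))) (hF : 1 ≤ ‖fMoment f (frequency σ)‖)
    (hK : ‖fMoment f (frequency σ)‖ ≤ 2 ^ K) {δ : ℝ} (hδ : 0 < δ) (hδ' : δ ≤ 1 / 40)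
    (hmδ : 400 ≤ m * δ ^ 2) :
    99 / 100 ≤ P {ω | ‖(levyTower X K).output ω σ - fMoment f (frequency σ)‖
      ≤ 60 * δ * ‖fMoment f (frequency σ)‖} := by
  refine (tower_levels_close hX hm (frequency σ) K hδ hmδ).trans (measure_mono fun ω hω => ?_)
  refine norm_scanLevels_sub_le hF hδ' K _ hK fun k hk => ?_
  simp_rw [levyTower_run_toCircle]
  exact hω k hk

/-- The tower with words of `b` bits has relative error `60 (δ + ρ)` with probability at least
`99/100`, if rounding moves no register by more than `ρ`. -/
lemma levyTowerBits_accuracy (hX : IsLevyCopies X P f) (hm : 0 < m) (K b : ℕ)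
    (σ : List (Fin n × EuclideanSpace ℝ (Fin d))) (hF : 1 ≤ ‖fMoment f (frequency σ)‖)
    (hK : ‖fMoment f (frequency σ)‖ ≤ 2 ^ K) {δ ρ : ℝ} (hδ : 0 < δ) (hδ' : δ + ρ ≤ 1 / 40)
    (hmδ : 400 ≤ m * δ ^ 2) (hρ : σ.length * (Real.pi / 2 ^ b) ≤ ρ) :
    99 / 100 ≤ P {ω | ‖(levyTowerBits X K b).output ω σ - fMoment f (frequency σ)‖
      ≤ 60 * (δ + ρ) * ‖fMoment f (frequency σ)‖} := by
  refine (tower_levels_close hX hm (frequency σ) K hδ hmδ).trans (measure_mono fun ω hω => ?_)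
  refine norm_scanLevels_sub_le hF hδ' K _ hK fun k hk => ?_
  have h1 := hω k hk
  have hm' : (0 : ℝ) < m := by exact_mod_cast hm
  have h2 : ‖1 / (m : ℂ) * ∑ j, (ZMod.toCircle ((levyTowerBits X K b).run ω σ (k, j)) : ℂ)
      - 1 / (m : ℂ) * ∑ j, Complex.exp (pairing X ω (frequency σ) k j * Complex.I)‖ ≤ ρ := by
    rw [← mul_sub, ← Finset.sum_sub_distrib, norm_mul, norm_div, norm_one, Complex.norm_natCast,
      one_div, inv_mul_le_iff₀ hm']
    refine (norm_sum_le _ _).trans ?_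
    refine (Finset.sum_le_sum fun j _ =>
      (levyTowerBits_run_toCircle X K b ω σ (k, j)).trans hρ).trans ?_
    simp
  refine (norm_sub_le_norm_sub_add_norm_sub _ _ _).trans ((add_le_add h2 h1).trans ?_)
  linarith

end Tower

/-! ### Lévy's continuity theorem and compound Poisson laws. -/

section CharFun

open Filter Topology

variable {E : Type*} [NormedAddCommGroup E] [InnerProductSpace ℝ E]
  [MeasurableSpace E] [BorelSpace E]

lemma charFun_add_smul {μ ν : Measure E} [IsFiniteMeasure μ] [IsFiniteMeasure ν] (a b : ℝ≥0)
    (t : E) : charFun (a • μ + b • ν) t = a * charFun μ t + b * charFun ν t := by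
  have hi : ∀ (ρ : Measure E) [IsFiniteMeasure ρ],
      Integrable (fun x => Complex.exp (inner ℝ x t * Complex.I)) ρ := fun ρ _ =>
    Integrable.of_bound (Continuous.aestronglyMeasurable (by fun_prop)) 1
      (Eventually.of_forall fun x => by rw [Complex.norm_exp_ofReal_mul_I])
  simp only [charFun_apply]
  rw [integral_add_measure (hi _) (hi _), integral_smul_nnreal_measure,
    integral_smul_nnreal_measure]
  simp [NNReal.smul_def]

variable [FiniteDimensional ℝ E]

/-- **Lévy's continuity theorem**: a pointwise limit of characteristic functions that is
continuous at `0` is a characteristic function. -/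
theorem exists_charFun_eq_of_tendsto {μ : ℕ → Measure E} [∀ i, IsProbabilityMeasure (μ i)]
    {φ : E → ℂ} (hφ : ContinuousAt φ 0)
    (h : ∀ t, Tendsto (fun n => charFun (μ n) t) atTop (𝓝 (φ t))) :
    ∃ ρ : Measure E, IsProbabilityMeasure ρ ∧ ∀ t, charFun ρ t = φ t := by
  let p : ℕ → ProbabilityMeasure E := fun n => ⟨μ n, inferInstance⟩
  -- Continuity of the limit at `0` prevents escape of mass. Prokhorov's theorem then gives a
  -- cluster point, and an ultrafilter converging to it plays the role of a subsequence.
  have ht := isTightMeasureSet_of_tendsto_charFun hφ h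
  have hS : {((q : ProbabilityMeasure E) : Measure E) | q ∈ Set.range p} = Set.range μ := by
    ext q
    constructor
    · rintro ⟨_, ⟨n, rfl⟩, rfl⟩; exact ⟨n, rfl⟩
    · rintro ⟨n, rfl⟩; exact ⟨p n, ⟨n, rfl⟩, rfl⟩
  have hc : IsCompact (closure (Set.range p)) := by
    refine isCompact_closure_of_isTightMeasureSet ?_
    rw [hS]; exact ht
  obtain ⟨ρ, -, hρ⟩ := hc.exists_mapClusterPt (f := atTop) (u := p)
    (tendsto_principal.2 (Eventually.of_forall fun n => subset_closure ⟨n, rfl⟩))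
  obtain ⟨U, hU, hUρ⟩ := mapClusterPt_iff_ultrafilter.1 hρ
  refine ⟨ρ, inferInstance, fun t => ?_⟩
  rw [ProbabilityMeasure.tendsto_iff_forall_integral_rclike_tendsto ℂ] at hUρ
  have h1 := hUρ (BoundedContinuousFunction.innerProbChar t)
  simp_rw [← charFun_eq_integral_innerProbChar] at h1
  exact tendsto_nhds_unique h1 ((h t).mono_left hU)

/-- The compound Poisson law with finite jump measure `ρ`. -/
theorem exists_charFun_eq_compoundPoisson (ρ : Measure E) [IsFiniteMeasure ρ] :
    ∃ μ : Measure E, IsProbabilityMeasure μ ∧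
      ∀ t, charFun μ t = Complex.exp (charFun ρ t - ρ.real Set.univ) := by
  -- The shift by `N` keeps the weight `1 - r / (k + N)` of the atom at `0` from being truncated in
  -- `ℝ≥0`. The sum of `k + N` independent variables with law `π k` has transform `(1 + a / (k + N))
  -- ^ (k + N)`, which tends to `exp a`.
  obtain ⟨N, hN⟩ := exists_nat_ge (ρ.real Set.univ + 1)
  set r : ℝ≥0 := (ρ Set.univ).toNNReal with hr
  have hrr : ρ.real Set.univ = r := rfl
  have hru : ρ Set.univ = r := (ENNReal.coe_toNNReal (measure_ne_top _ _)).symm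
  have hpos : ∀ k : ℕ, (0 : ℝ) < (k + N : ℕ) := fun k => by
    have : (0 : ℝ) ≤ ρ.real Set.univ := measureReal_nonneg
    push_cast
    have : (0 : ℝ) ≤ k := by positivity
    linarith
  have hle : ∀ k : ℕ, r / (k + N : ℕ) ≤ 1 := fun k => by
    rw [← NNReal.coe_le_coe]
    push_cast
    have := hpos k
    push_cast at this
    rw [div_le_one this, ← hrr]
    have : (0 : ℝ) ≤ k := by positivity
    linarith
  let π : ℕ → Measure E := fun k =>
    (1 - r / (k + N : ℕ)) • Measure.dirac 0 + (1 / (k + N : ℕ) : ℝ≥0) • ρ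
  have hπ : ∀ k, IsProbabilityMeasure (π k) := fun k => ⟨by
    simp only [π, Measure.coe_add, Pi.add_apply, Measure.smul_apply, measure_univ, hru]
    rw [ENNReal.smul_def, ENNReal.smul_def, smul_eq_mul, smul_eq_mul, mul_one, ← ENNReal.coe_mul,
      ← ENNReal.coe_add, one_div, mul_comm, ← div_eq_mul_inv, tsub_add_cancel_of_le (hle k)]
    simp⟩
  have hπc : ∀ k t, charFun (π k) t = 1 + (charFun ρ t - ρ.real Set.univ) / (k + N : ℕ) := by
    intro k t
    rw [charFun_add_smul, charFun_dirac, hrr, NNReal.coe_sub (hle k)]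
    push_cast
    simp; ring
  have hprob : ∀ k : ℕ, IsProbabilityMeasure
      ((Measure.pi fun _ : Fin (k + N) => π k).map fun p => ∑ i, p i) := fun k =>
    Measure.isProbabilityMeasure_map (Measurable.aemeasurable (by fun_prop))
  refine exists_charFun_eq_of_tendsto (φ := fun t => Complex.exp (charFun ρ t - ρ.real Set.univ))
    (μ := fun k : ℕ => (Measure.pi fun _ : Fin (k + N) => π k).map fun p => ∑ i, p i) ?_ ?_
  · have : Continuous fun t => Complex.exp (charFun ρ t - ρ.real Set.univ) := by fun_prop
    exact this.continuousAt
  · intro t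
    have h1 := (Complex.tendsto_one_add_div_pow_exp (charFun ρ t - ρ.real Set.univ)).comp
      (tendsto_add_atTop_nat N)
    refine h1.congr fun k => ?_
    rw [charFun_map_sum_pi_eq_prod]
    simp [hπc]

end CharFun

/-! ### Lévy–Khintchine exponents and their infinitely divisible laws. -/

section Exponent

open Filter Topology

variable {d : ℕ}

/-- The integrand of the Lévy–Khintchine formula. -/
noncomputable def jumpIntegrand (z s : EuclideanSpace ℝ (Fin d)) : ℂ :=
  1 + Complex.I * ((if ‖s‖ < 1 then inner ℝ z s else 0 : ℝ) : ℂ)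
    - Complex.exp (Complex.I * ((inner ℝ z s : ℝ) : ℂ))

lemma norm_one_add_I_mul_sub_exp_le (x : ℝ) :
    ‖1 + Complex.I * x - Complex.exp (Complex.I * x)‖ ≤ 3 * x ^ 2 := by
  by_cases hx : |x| ≤ 1
  · have h := norm_exp_sub_one_sub_le (w := Complex.I * x) (by simpa using hx)
    rw [← norm_neg]
    calc _ = ‖Complex.exp (Complex.I * x) - 1 - Complex.I * x‖ := by congr 1; ring
      _ ≤ 3 / 4 * ‖Complex.I * x‖ ^ 2 := h
      _ = 3 / 4 * x ^ 2 := by simp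
      _ ≤ 3 * x ^ 2 := by nlinarith [sq_nonneg x]
  · have h1 : 1 < |x| := not_le.1 hx
    calc _ ≤ ‖1 + Complex.I * x‖ + ‖Complex.exp (Complex.I * x)‖ := norm_sub_le _ _
      _ ≤ (1 + |x|) + 1 := by
        gcongr
        · refine (norm_add_le _ _).trans ?_
          simp
        · rw [mul_comm, Complex.norm_exp_ofReal_mul_I]
      _ ≤ 3 * |x| ^ 2 := by nlinarith
      _ = 3 * x ^ 2 := by rw [sq_abs]

/-- The compensator cancels the linear term for small jumps, and large jumps contribute at most `2`.
The bound is locally uniform in `z`, as dominated convergence requires. -/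
lemma norm_jumpIntegrand_le (z s : EuclideanSpace ℝ (Fin d)) :
    ‖jumpIntegrand z s‖ ≤ 3 * (1 + ‖z‖ ^ 2) * min (‖s‖ ^ 2) 1 := by
  rw [jumpIntegrand]
  split_ifs with h
  · have h1 : ‖s‖ ^ 2 ≤ 1 := by nlinarith [norm_nonneg s]
    rw [min_eq_left h1]
    refine (norm_one_add_I_mul_sub_exp_le _).trans ?_
    have h2 : (inner ℝ z s : ℝ) ^ 2 ≤ (‖z‖ * ‖s‖) ^ 2 := by
      rw [← sq_abs]
      gcongr
      exact abs_real_inner_le_norm z s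
    nlinarith [sq_nonneg ‖s‖]
  · have h1 : 1 ≤ ‖s‖ ^ 2 := by nlinarith [not_lt.1 h]
    rw [min_eq_right h1]
    have : ‖1 + Complex.I * ((0 : ℝ) : ℂ) - Complex.exp (Complex.I * ((inner ℝ z s : ℝ) : ℂ))‖
        ≤ 1 + 1 := by
      refine (norm_sub_le _ _).trans ?_
      rw [mul_comm _ (((inner ℝ z s : ℝ) : ℂ)), Complex.norm_exp_ofReal_mul_I]
      simp
    nlinarith [sq_nonneg ‖z‖]

lemma measurable_jumpIntegrand (z : EuclideanSpace ℝ (Fin d)) :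
    Measurable (jumpIntegrand z) := by
  have h1 : Measurable fun s : EuclideanSpace ℝ (Fin d) => (inner ℝ z s : ℝ) := by fun_prop
  have h2 : Measurable fun s : EuclideanSpace ℝ (Fin d) =>
      (if ‖s‖ < 1 then inner ℝ z s else 0 : ℝ) :=
    Measurable.ite (measurableSet_lt measurable_norm measurable_const) h1 measurable_const
  unfold jumpIntegrand
  fun_prop

lemma IsJumpMeasure.integrable_min {ν : Measure (EuclideanSpace ℝ (Fin d))}
    (hν : IsJumpMeasure ν) : Integrable (fun s => min (‖s‖ ^ 2) 1) ν := by
  refine ⟨Continuous.aestronglyMeasurable (by fun_prop), ?_⟩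
  rw [hasFiniteIntegral_iff_ofReal (Eventually.of_forall fun s => by positivity)]
  exact hν

lemma IsJumpMeasure.integrable_jumpIntegrand {ν : Measure (EuclideanSpace ℝ (Fin d))}
    (hν : IsJumpMeasure ν) (z : EuclideanSpace ℝ (Fin d)) : Integrable (jumpIntegrand z) ν :=
  (hν.integrable_min.const_mul (3 * (1 + ‖z‖ ^ 2))).mono'
    (measurable_jumpIntegrand z).aestronglyMeasurable
    (Eventually.of_forall (norm_jumpIntegrand_le z))

lemma continuous_levyExponent (A : Matrix (Fin d) (Fin d) ℝ) (γ : EuclideanSpace ℝ (Fin d))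
    {ν : Measure (EuclideanSpace ℝ (Fin d))} (hν : IsJumpMeasure ν) :
    Continuous (levyExponent A γ ν) := by
  have hJ : Continuous fun z => ∫ s, jumpIntegrand z s ∂ν := by
    rw [continuous_iff_continuousAt]
    intro z₀
    refine continuousAt_of_dominated
      (bound := fun s => 3 * (1 + (‖z₀‖ + 1) ^ 2) * min (‖s‖ ^ 2) 1)
      (Eventually.of_forall fun z => (measurable_jumpIntegrand z).aestronglyMeasurable) ?_
      (hν.integrable_min.const_mul _) ?_
    · filter_upwards [Metric.ball_mem_nhds z₀ one_pos] with z hz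
      refine Eventually.of_forall fun s => (norm_jumpIntegrand_le z s).trans ?_
      have : ‖z‖ ≤ ‖z₀‖ + 1 := by
        rw [Metric.mem_ball, dist_eq_norm] at hz
        have := norm_sub_norm_le z z₀
        linarith
      gcongr
    · refine Eventually.of_forall fun s => Continuous.continuousAt ?_
      unfold jumpIntegrand
      by_cases h : ‖s‖ < 1 <;> simp only [h, if_true, if_false] <;> fun_prop
  have h1 : Continuous fun z : EuclideanSpace ℝ (Fin d) => z.ofLp ⬝ᵥ (A *ᵥ z.ofLp) := by
    fun_prop
  have h2 : Continuous fun z : EuclideanSpace ℝ (Fin d) => (inner ℝ γ z : ℝ) := by fun_prop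
  have e : levyExponent A γ ν = fun z => 1 / 2 * ((z.ofLp ⬝ᵥ (A *ᵥ z.ofLp) : ℝ) : ℂ)
      - Complex.I * ((inner ℝ γ z : ℝ) : ℂ) + ∫ s, jumpIntegrand z s ∂ν := rfl
  rw [e]
  fun_prop

lemma levyExponent_zero (A : Matrix (Fin d) (Fin d) ℝ) (γ : EuclideanSpace ℝ (Fin d))
    (ν : Measure (EuclideanSpace ℝ (Fin d))) : levyExponent A γ ν 0 = 0 := by
  simp [levyExponent]

/-- For a finite jump measure, the law is a Gaussian convolved with a compound Poisson law. -/
lemma exists_charFun_eq_exp_neg_levyExponent_of_finite {A : Matrix (Fin d) (Fin d) ℝ}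
    (hA : A.PosSemidef) (γ : EuclideanSpace ℝ (Fin d))
    (ν : Measure (EuclideanSpace ℝ (Fin d))) [IsFiniteMeasure ν] :
    ∃ μ : Measure (EuclideanSpace ℝ (Fin d)), IsProbabilityMeasure μ ∧
      ∀ z, charFun μ z = Complex.exp (-levyExponent A γ ν z) := by
  obtain ⟨ρ, hρ, hρc⟩ := exists_charFun_eq_compoundPoisson ν
  let B : Set (EuclideanSpace ℝ (Fin d)) := {s | ‖s‖ < 1}
  have hB : MeasurableSet B := measurableSet_lt measurable_norm measurable_const
  let b : EuclideanSpace ℝ (Fin d) := ∫ s in B, s ∂ν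
  have hbi : IntegrableOn (fun s : EuclideanSpace ℝ (Fin d) => s) B ν := by
    refine Integrable.of_bound (C := 1) (by fun_prop) ?_
    filter_upwards [ae_restrict_mem hB] with s hs using le_of_lt hs
  -- For finite `ν` the compensator integrates to `i⟨z, b⟩` and is absorbed into the drift.
  refine ⟨multivariateGaussian (γ - b) A ∗ ρ, inferInstance, fun z => ?_⟩
  rw [charFun_conv, hρc, charFun_multivariateGaussian hA, ← Complex.exp_add, levyExponent]
  congr 1
  have hdrift : ∫ s, (if ‖s‖ < 1 then inner ℝ z s else 0 : ℝ) ∂ν = inner ℝ z b := by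
    have e : (fun s : EuclideanSpace ℝ (Fin d) => (if ‖s‖ < 1 then inner ℝ z s else 0 : ℝ))
        = B.indicator fun s => inner ℝ z s := by
      ext s; simp [B, Set.indicator_apply]
    rw [e, integral_indicator hB]
    exact integral_inner hbi z
  have i1 : Integrable (fun s : EuclideanSpace ℝ (Fin d) =>
      (if ‖s‖ < 1 then inner ℝ z s else 0 : ℝ)) ν := by
    have e : (fun s : EuclideanSpace ℝ (Fin d) => (if ‖s‖ < 1 then inner ℝ z s else 0 : ℝ))
        = B.indicator fun s => inner ℝ z s := by
      ext s; simp [B, Set.indicator_apply]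
    rw [e, integrable_indicator_iff hB]
    exact hbi.const_inner z
  have i1' : Integrable (fun s : EuclideanSpace ℝ (Fin d) =>
      Complex.I * ((if ‖s‖ < 1 then inner ℝ z s else 0 : ℝ) : ℂ)) ν := i1.ofReal.const_mul _
  have i2 : Integrable (fun s : EuclideanSpace ℝ (Fin d) =>
      Complex.exp (Complex.I * ((inner ℝ z s : ℝ) : ℂ))) ν :=
    Integrable.of_bound (Continuous.aestronglyMeasurable (by fun_prop)) 1
      (Eventually.of_forall fun s => by rw [mul_comm, Complex.norm_exp_ofReal_mul_I])
  have i3 : Integrable (fun s : EuclideanSpace ℝ (Fin d) =>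
      1 + Complex.I * ((if ‖s‖ < 1 then inner ℝ z s else 0 : ℝ) : ℂ)) ν :=
    (integrable_const _).add i1'
  rw [integral_sub i3 i2, integral_add (integrable_const _) i1', integral_const_mul,
    integral_complex_ofReal, hdrift]
  have hc : charFun ν z = ∫ s, Complex.exp (Complex.I * ((inner ℝ z s : ℝ) : ℂ)) ∂ν := by
    rw [charFun_apply]
    refine integral_congr_ae (Eventually.of_forall fun s => ?_)
    simp only [real_inner_comm, mul_comm]
  rw [← hc, inner_sub_right, real_inner_comm γ z]
  simp
  ring

/-- **Existence of infinitely divisible laws**: `exp (-f)` is a characteristic function for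
every Lévy–Khintchine exponent `f`. -/
theorem exists_charFun_eq_exp_neg_levyExponent {A : Matrix (Fin d) (Fin d) ℝ}
    (hA : A.PosSemidef) (γ : EuclideanSpace ℝ (Fin d))
    {ν : Measure (EuclideanSpace ℝ (Fin d))} (hν : IsJumpMeasure ν) :
    ∃ μ : Measure (EuclideanSpace ℝ (Fin d)), IsProbabilityMeasure μ ∧
      ∀ z, charFun μ z = Complex.exp (-levyExponent A γ ν z) := by
  let B : ℕ → Set (EuclideanSpace ℝ (Fin d)) := fun k => {s | 1 / ((k : ℝ) + 1) ≤ ‖s‖}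
  have hB : ∀ k, MeasurableSet (B k) := fun k => measurableSet_le measurable_const measurable_norm
  have hfin : ∀ k, IsFiniteMeasure (ν.restrict (B k)) := by
    intro k
    refine ⟨?_⟩
    rw [Measure.restrict_apply_univ]
    have hc : 0 < (1 / ((k : ℝ) + 1)) ^ 2 := by positivity
    refine (measure_mono ?_).trans_lt (hν.integrable_min.measure_ge_lt_top hc)
    intro s hs
    have hs' : 1 / ((k : ℝ) + 1) ≤ ‖s‖ := hs
    have h1 : 1 / ((k : ℝ) + 1) ≤ 1 := by
      rw [div_le_one (by positivity)]
      have : (0 : ℝ) ≤ k := by positivity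
      linarith
    have h0 : 0 ≤ 1 / ((k : ℝ) + 1) := by positivity
    change (1 / ((k : ℝ) + 1)) ^ 2 ≤ min (‖s‖ ^ 2) 1
    refine le_min ?_ ?_
    · gcongr
    · exact pow_le_one₀ h0 h1
  choose μ hμ hμc using fun k =>
    exists_charFun_eq_exp_neg_levyExponent_of_finite hA γ (ν.restrict (B k))
  refine exists_charFun_eq_of_tendsto (μ := μ)
    (φ := fun z => Complex.exp (-levyExponent A γ ν z)) ?_ fun z => ?_
  · have := continuous_levyExponent A γ hν
    exact Continuous.continuousAt (by fun_prop)
  · simp_rw [hμc]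
    refine (Complex.continuous_exp.tendsto _).comp (Tendsto.neg ?_)
    refine Tendsto.const_add _ ?_
    change Tendsto (fun k => ∫ s, jumpIntegrand z s ∂(ν.restrict (B k))) atTop
      (𝓝 (∫ s, jumpIntegrand z s ∂ν))
    simp_rw [← integral_indicator (hB _)]
    refine tendsto_integral_of_dominated_convergence (fun s => ‖jumpIntegrand z s‖)
      (fun k => ((measurable_jumpIntegrand z).indicator (hB k)).aestronglyMeasurable)
      (hν.integrable_jumpIntegrand z).norm
      (fun k => Eventually.of_forall fun s => norm_indicator_le_norm_self _ _)
      (Eventually.of_forall fun s => ?_)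
    -- The sets `B k` exhaust only `s ≠ 0`. The measure `ν` may charge the origin, even with
    -- infinite mass, but the integrand vanishes there.
    by_cases hs : s = 0
    · have : jumpIntegrand z s = 0 := by simp [jumpIntegrand, hs]
      simp [Set.indicator_apply, this]
    · refine tendsto_const_nhds.congr' ?_
      have h := (tendsto_one_div_add_atTop_nhds_zero_nat (𝕜 := ℝ)).eventually
        (Iio_mem_nhds (norm_pos_iff.2 hs))
      filter_upwards [h] with k hk
      rw [Set.indicator_of_mem]
      exact le_of_lt hk

/-- The exponent is linear in the triplet, so the law at any time `t` comes from the existence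
theorem at time `1`. -/
lemma levyExponent_smul (t : ℝ≥0) (A : Matrix (Fin d) (Fin d) ℝ)
    (γ : EuclideanSpace ℝ (Fin d)) (ν : Measure (EuclideanSpace ℝ (Fin d)))
    (z : EuclideanSpace ℝ (Fin d)) :
    levyExponent ((t : ℝ) • A) ((t : ℝ) • γ) (t • ν) z = t * levyExponent A γ ν z := by
  rw [levyExponent, levyExponent, integral_smul_nnreal_measure, inner_smul_left, Matrix.smul_mulVec,
    dotProduct_smul]
  simp [NNReal.smul_def]
  ring

theorem exists_charFun_eq_exp_neg_mul_levyExponent {A : Matrix (Fin d) (Fin d) ℝ}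
    (hA : A.PosSemidef) (γ : EuclideanSpace ℝ (Fin d))
    {ν : Measure (EuclideanSpace ℝ (Fin d))} (hν : IsJumpMeasure ν) (t : ℝ≥0) :
    ∃ μ : Measure (EuclideanSpace ℝ (Fin d)), IsProbabilityMeasure μ ∧
      ∀ z, charFun μ z = Complex.exp (-(t * levyExponent A γ ν z)) := by
  have hν' : IsJumpMeasure (t • ν) := by
    rw [IsJumpMeasure, lintegral_smul_measure]
    exact ENNReal.mul_lt_top ENNReal.coe_lt_top hν
  obtain ⟨μ, hμ, h⟩ := exists_charFun_eq_exp_neg_levyExponent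
    (hA.smul t.coe_nonneg) ((t : ℝ) • γ) hν'
  exact ⟨μ, hμ, fun z => by rw [h, levyExponent_smul]⟩

end Exponent

/-! ### Kolmogorov's extension theorem. -/

section Kolmogorov

open Filter Topology

variable {ι : Type*}

/-- Continuity at `∅` of the content of a projective family over a compact space. -/
lemma tendsto_projectiveFamilyContent_zero {K : Type*} [TopologicalSpace K] [CompactSpace K]
    [SecondCountableTopology K] [TopologicalSpace.PseudoMetrizableSpace K] [MeasurableSpace K]
    [BorelSpace K] {P : ∀ J : Finset ι, Measure (J → K)} [∀ J, IsProbabilityMeasure (P J)]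
    (hP : IsProjectiveMeasureFamily (α := fun _ : ι => K) P) {A : ℕ → Set (ι → K)}
    (hA : ∀ n, A n ∈ measurableCylinders fun _ : ι => K) (hanti : Antitone A)
    (hempty : ⋂ n, A n = ∅) :
    Tendsto (fun n => projectiveFamilyContent hP (A n)) atTop (𝓝 0) := by
  rw [ENNReal.tendsto_atTop_zero]
  intro ε hε
  obtain ⟨e, he, hes⟩ := ENNReal.exists_pos_sum_of_countable' hε.ne' ℕ
  have hF : ∀ n, ∃ F : Set (ι → K), F ∈ measurableCylinders (fun _ : ι => K) ∧ F ⊆ A n ∧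
      IsClosed F ∧ projectiveFamilyContent hP (A n \ F) ≤ e n := by
    intro n
    obtain ⟨I, S, hS, hAS⟩ := (mem_measurableCylinders _).1 (hA n)
    obtain ⟨C, hCS, hC, hlt⟩ :=
      hS.exists_isClosed_sdiff_lt (μ := P I) (measure_ne_top _ _) (he n).ne'
    refine ⟨cylinder I C, cylinder_mem_measurableCylinders _ _ hC.measurableSet, ?_,
      hC.cylinder I, ?_⟩
    · rw [hAS]; exact Set.preimage_mono hCS
    · rw [hAS, sdiff_cylinder_same, projectiveFamilyContent_cylinder hP (hS.diff hC.measurableSet)]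
      exact hlt.le
  choose F hFm hFA hFc hFe using hF
  -- Closed cylinders in a product of compact spaces are compact, so the empty intersection is
  -- already empty at a finite stage.
  have hN : ∃ N, ⋂ k ∈ Finset.range (N + 1), F k = ∅ := by
    by_contra! h
    have := IsCompact.nonempty_iInter_of_sequence_nonempty_isCompact_isClosed
      (fun N => ⋂ k ∈ Finset.range (N + 1), F k)
      (fun N => Set.biInter_subset_biInter_left
        (Finset.range_mono (Nat.le_succ _))) h
      (isClosed_biInter fun k _ => hFc k).isCompact (fun N => isClosed_biInter fun k _ => hFc k)
    obtain ⟨x, hx⟩ := this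
    have : x ∈ ⋂ n, A n := by
      refine Set.mem_iInter.2 fun n => hFA n ?_
      have h1 := Set.mem_iInter.1 hx n
      exact Set.mem_iInter₂.1 h1 n (Finset.self_mem_range_succ n)
    rw [hempty] at this
    exact this
  obtain ⟨N, hN⟩ := hN
  refine ⟨N, fun n hn => ?_⟩
  have hD : ∀ k, A k \ F k ∈ measurableCylinders fun _ : ι => K := fun k =>
    sdiff_mem_measurableCylinders (hA k) (hFm k)
  -- A point of `A n` misses some `F k` with `k ≤ N ≤ n`, and lies in `A k` by monotonicity.
  have hsub : A n ⊆ ⋃ k ∈ Finset.range (N + 1), A k \ F k := by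
    intro x hx
    by_contra hcon
    have : x ∈ ⋂ k ∈ Finset.range (N + 1), F k := by
      refine Set.mem_iInter₂.2 fun k hk => ?_
      by_contra hxF
      refine hcon (Set.mem_iUnion₂.2 ⟨k, hk, ?_, hxF⟩)
      exact hanti ((Finset.mem_range_succ_iff.1 hk).trans hn) hx
    rw [hN] at this
    exact this
  calc projectiveFamilyContent hP (A n)
      ≤ projectiveFamilyContent hP (⋃ k ∈ Finset.range (N + 1), A k \ F k) :=
        projectiveFamilyContent_mono hP (hA n)
          (isSetRing_measurableCylinders.biUnion_mem _ fun k _ => hD k) hsub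
    _ ≤ ∑ k ∈ Finset.range (N + 1), projectiveFamilyContent hP (A k \ F k) :=
        addContent_biUnion_le isSetRing_measurableCylinders fun k _ => hD k
    _ ≤ ∑ k ∈ Finset.range (N + 1), e k := Finset.sum_le_sum fun k _ => hFe k
    _ ≤ ∑' k, e k := ENNReal.sum_le_tsum _
    _ ≤ ε := hes.le

lemma exists_isProjectiveLimit_of_compact {K : Type*} [TopologicalSpace K] [CompactSpace K]
    [SecondCountableTopology K] [TopologicalSpace.PseudoMetrizableSpace K] [MeasurableSpace K]
    [BorelSpace K] {P : ∀ J : Finset ι, Measure (J → K)} [∀ J, IsProbabilityMeasure (P J)]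
    (hP : IsProjectiveMeasureFamily (α := fun _ : ι => K) P) :
    ∃ μ : Measure (ι → K), IsProjectiveLimit (α := fun _ : ι => K) μ P := by
  have hσ : (projectiveFamilyContent hP).IsSigmaSubadditive :=
    isSigmaSubadditive_of_addContent_iUnion_eq_tsum isSetRing_measurableCylinders
      fun f hf hU hd => addContent_iUnion_eq_sum_of_tendsto_zero isSetRing_measurableCylinders
        (projectiveFamilyContent hP) (fun s hs => projectiveFamilyContent_ne_top _)
        (fun _ => tendsto_projectiveFamilyContent_zero hP) hf hU hd
  refine ⟨(projectiveFamilyContent hP).measure isSetSemiring_measurableCylinders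
    generateFrom_measurableCylinders.ge hσ, fun I => ?_⟩
  ext s hs
  rw [Measure.map_apply (by fun_prop) hs, AddContent.measure_eq, ← cylinder,
    projectiveFamilyContent_cylinder hP hs]
  · exact generateFrom_measurableCylinders.symm
  · exact cylinder_mem_measurableCylinders _ _ hs

/-- **Kolmogorov's extension theorem** for processes with values in a standard Borel space. -/
theorem exists_isProjectiveLimit {E : Type*} [MeasurableSpace E] [StandardBorelSpace E]
    [Nonempty E] {P : ∀ J : Finset ι, Measure (J → E)} [∀ J, IsProbabilityMeasure (P J)]
    (hP : IsProjectiveMeasureFamily (α := fun _ : ι => E) P) :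
    ∃ μ : Measure (ι → E), IsProjectiveLimit (α := fun _ : ι => E) μ P := by
  -- The space embeds measurably into the compact Cantor space `ℕ → Bool`, with measurable left
  -- inverse `r`; the family is transported there, extended, and carried back by `r`.
  obtain ⟨g, hg, hginj⟩ := MeasurableSpace.measurable_injection_nat_bool_of_countablySeparated E
  obtain ⟨r, hr, hrg⟩ := (hg.measurableEmbedding hginj).exists_measurable_extend
    measurable_id (fun _ => inferInstance)
  have hgJ : ∀ J : Finset ι, Measurable fun (x : J → E) (i : J) => g (x i) := fun J => by fun_prop
  have hrJ : ∀ J : Finset ι, Measurable fun (x : J → ℕ → Bool) (i : J) => r (x i) := fun J => by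
    fun_prop
  let Q : ∀ J : Finset ι, Measure (J → ℕ → Bool) := fun J => (P J).map fun x i => g (x i)
  have hQp : ∀ J, IsProbabilityMeasure (Q J) := fun J =>
    Measure.isProbabilityMeasure_map (hgJ J).aemeasurable
  have hQ : IsProjectiveMeasureFamily (α := fun _ : ι => ℕ → Bool) Q := by
    intro I J hJI
    simp only [Q]
    rw [hP I J hJI, Measure.map_map (hgJ J) (Finset.measurable_restrict₂ hJI)]
    exact (Measure.map_map (Finset.measurable_restrict₂ (X := fun _ : ι => ℕ → Bool) hJI)
      (hgJ I)).symm
  obtain ⟨μ, hμ⟩ := exists_isProjectiveLimit_of_compact hQ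
  refine ⟨μ.map fun x i => r (x i), fun I => ?_⟩
  have e : (I.restrict ∘ fun (x : ι → ℕ → Bool) (i : ι) => r (x i))
      = (fun (x : I → ℕ → Bool) (i : I) => r (x i)) ∘ I.restrict := rfl
  rw [Measure.map_map (by fun_prop) (by fun_prop)]
  rw [e, ← Measure.map_map (hrJ I) (by fun_prop), hμ I]
  simp only [Q]
  rw [Measure.map_map (hrJ I) (hgJ I)]
  have e2 : (fun (x : I → ℕ → Bool) (i : I) => r (x i)) ∘ (fun (x : I → E) (i : I) => g (x i))
      = id := by
    ext1 x; ext1 i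
    exact congrFun hrg (x i)
  rw [e2, Measure.map_id]

end Kolmogorov

/-! ### Path laws with a prescribed joint characteristic function. -/

section FiniteDimensionalLaws

open Filter Topology

lemma integral_Ioi_indicator_Ico {a b : ℝ≥0} (hab : b ≤ a) (c : ℂ) :
    ∫ u in Set.Ioi (0 : ℝ), (Set.Ico (b : ℝ) a).indicator (fun _ => c) u
      = ((a - b : ℝ≥0) : ℝ) * c := by
  have h : Set.Ico (b : ℝ) a ∩ Set.Ici 0 = Set.Ico (b : ℝ) a :=
    Set.inter_eq_left.2 fun u hu => b.coe_nonneg.trans hu.1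
  -- The interval `[b, a)` may contain the endpoint `0` that `Ioi 0` omits; a single point is null.
  rw [← integral_Ici_eq_integral_Ioi, integral_indicator measurableSet_Ico,
    Measure.restrict_restrict measurableSet_Ico, h, setIntegral_const, Real.volume_real_Ico_of_le
      (NNReal.coe_le_coe.2 hab), NNReal.coe_sub hab, Complex.real_smul]

variable {E : Type*} [NormedAddCommGroup E] [InnerProductSpace ℝ E]

/-- The pairing `∑ₜ ⟨x t, θ t⟩` of a path with a finitely supported family of frequencies. -/
noncomputable def pathPairing (x : ℝ≥0 → E) : (ℝ≥0 →₀ E) →ₗ[ℝ] ℝ :=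
  Finsupp.lsum ℝ fun t => innerₗ E (x t)

/-- The total frequency `∑_{t > u} θ t` after time `u`. -/
noncomputable def tailSum (u : ℝ) : (ℝ≥0 →₀ E) →ₗ[ℝ] E :=
  Finsupp.lsum ℝ fun t => if u < t then LinearMap.id else 0

lemma pathPairing_single (x : ℝ≥0 → E) (t : ℝ≥0) (v : E) :
    pathPairing x (Finsupp.single t v) = inner ℝ (x t) v := by
  simp [pathPairing]

lemma pathPairing_eq_sum (x : ℝ≥0 → E) (θ : ℝ≥0 →₀ E) :
    pathPairing x θ = ∑ t ∈ θ.support, inner ℝ (x t) (θ t) := by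
  simp [pathPairing, Finsupp.sum]

lemma tailSum_single (u : ℝ) (t : ℝ≥0) (v : E) :
    tailSum u (Finsupp.single t v) = if u < t then v else 0 := by
  rw [tailSum, Finsupp.lsum_single]
  split_ifs <;> simp

lemma tailSum_eq_sum (u : ℝ) (θ : ℝ≥0 →₀ E) :
    tailSum u θ = ∑ t ∈ θ.support, if u < t then θ t else 0 := by
  rw [tailSum, Finsupp.lsum_apply, Finsupp.sum]
  refine Finset.sum_congr rfl fun t _ => ?_
  split_ifs <;> simp

lemma tailSum_eq_zero {u : ℝ} {θ : ℝ≥0 →₀ E} (h : ∀ t ∈ θ.support, (t : ℝ) ≤ u) :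
    tailSum u θ = 0 := by
  rw [tailSum_eq_sum]
  exact Finset.sum_eq_zero fun t ht => if_neg (not_lt.2 (h t ht))

/-- The exponent `∫₀^∞ f(∑_{t > u} θ t) du` of the joint characteristic function of a Lévy process
with characteristic exponent `f`. -/
noncomputable def jointExponent (f : E → ℂ) (θ : ℝ≥0 →₀ E) : ℂ :=
  ∫ u in Set.Ioi (0 : ℝ), f (tailSum u θ)

/-- The one-point marginal of the path laws. -/
lemma jointExponent_single {f : E → ℂ} (hf0 : f 0 = 0) (t : ℝ≥0) (v : E) :
    jointExponent f (Finsupp.single t v) = (t : ℝ) * f v := by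
  have key : ∀ u ∈ Set.Ioi (0 : ℝ), f (tailSum u (Finsupp.single t v))
      = (Set.Ico ((0 : ℝ≥0) : ℝ) t).indicator (fun _ => f v) u := by
    intro u hu
    rw [tailSum_single]
    by_cases h : u < t
    · rw [if_pos h, Set.indicator_of_mem
        (show u ∈ Set.Ico ((0 : ℝ≥0) : ℝ) t from ⟨by simpa using (Set.mem_Ioi.1 hu).le, h⟩)]
    · rw [if_neg h, Set.indicator_of_notMem (by simp [not_lt.1 h]), hf0]
  rw [jointExponent, setIntegral_congr_fun measurableSet_Ioi key,
    integral_Ioi_indicator_Ico zero_le]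
  simp

variable [MeasurableSpace E]

lemma integral_exp_inner_eq_charFun (μ : Measure E) (v : E) :
    ∫ y, Complex.exp (Complex.I * (inner ℝ y v : ℝ)) ∂μ = charFun μ v := by
  rw [charFun_apply]
  simp_rw [mul_comm]

/-- The law `P` on path space has the finite-dimensional laws of a Lévy process with exponent `f`
as far as the times in `I` are concerned. -/
def HasLevyLaws (f : E → ℂ) (P : Measure (ℝ≥0 → E)) (I : Set ℝ≥0) : Prop :=
  ∀ θ : ℝ≥0 →₀ E, ↑θ.support ⊆ I →
    ∫ x, Complex.exp (Complex.I * (pathPairing x θ : ℝ)) ∂P = Complex.exp (-jointExponent f θ)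

variable {f : E → ℂ}

lemma HasLevyLaws.mono {P : Measure (ℝ≥0 → E)} {I J : Set ℝ≥0} (h : HasLevyLaws f P I)
    (hJ : J ⊆ I) : HasLevyLaws f P J := fun θ hθ => h θ (hθ.trans hJ)

variable [BorelSpace E] [SecondCountableTopology E]

lemma measurable_pathPairing (θ : ℝ≥0 →₀ E) : Measurable fun x : ℝ≥0 → E => pathPairing x θ := by
  simp_rw [pathPairing_eq_sum]
  exact Finset.measurable_sum _ fun t _ => (measurable_pi_apply t).inner_const

/-- The tail sum takes finitely many values, all of them partial sums of `θ`, and vanishes after the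
last time. -/
lemma integrableOn_comp_tailSum (hf : Continuous f) (hf0 : f 0 = 0) (θ : ℝ≥0 →₀ E) :
    IntegrableOn (fun u => f (tailSum u θ)) (Set.Ioi 0) := by
  have hm : Measurable fun u : ℝ => f (tailSum u θ) := by
    refine hf.measurable.comp ?_
    simp_rw [tailSum_eq_sum]
    refine Finset.measurable_sum _ fun t _ => ?_
    exact Measurable.ite measurableSet_Iio measurable_const measurable_const
  have hb : ∀ u, ‖f (tailSum u θ)‖ ≤ ∑ T ∈ θ.support.powerset, ‖f (∑ t ∈ T, θ t)‖ := by
    intro u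
    rw [tailSum_eq_sum, ← Finset.sum_filter]
    exact Finset.single_le_sum (f := fun T => ‖f (∑ t ∈ T, θ t)‖) (fun T _ => norm_nonneg _)
      (Finset.mem_powerset.2 (Finset.filter_subset _ _))
  have h1 : IntegrableOn (fun u => f (tailSum u θ)) (Set.Ioc 0 ((θ.support.sup id : ℝ≥0) : ℝ)) :=
    Measure.integrableOn_of_bounded measure_Ioc_lt_top.ne hm.aestronglyMeasurable
      (Eventually.of_forall hb)
  refine h1.of_forall_sdiff_eq_zero measurableSet_Ioi fun u hu => ?_
  rw [tailSum_eq_zero, hf0]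
  intro t ht
  have : t ≤ θ.support.sup id := Finset.le_sup (f := id) ht
  have h2 : ((θ.support.sup id : ℝ≥0) : ℝ) < u := by
    by_contra! h
    exact hu.2 ⟨hu.1, h⟩
  exact (NNReal.coe_le_coe.2 this).trans h2.le

/-- Moving the mass of the last time `a` to an earlier time `b`. -/
lemma jointExponent_add_single (hf : Continuous f) (hf0 : f 0 = 0) {θ : ℝ≥0 →₀ E} {a b : ℝ≥0}
    (hab : b ≤ a) (hθ : ∀ t ∈ θ.support, t ≤ b) (v : E) :
    jointExponent f (θ + Finsupp.single a v)
      = jointExponent f (θ + Finsupp.single b v) + ((a - b : ℝ≥0) : ℝ) * f v := by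
  have key : ∀ u : ℝ, f (tailSum u (θ + Finsupp.single a v))
      = f (tailSum u (θ + Finsupp.single b v)) + (Set.Ico (b : ℝ) a).indicator (fun _ => f v) u := by
    intro u
    rw [map_add, map_add, tailSum_single, tailSum_single]
    have hab' : (b : ℝ) ≤ a := hab
    by_cases hu : u < b
    · rw [if_pos hu, if_pos (hu.trans_le hab'), Set.indicator_of_notMem (by simp [hu]), add_zero]
    · have : tailSum u θ = 0 :=
        tailSum_eq_zero fun t ht => (NNReal.coe_le_coe.2 (hθ t ht)).trans (not_lt.1 hu)
      rw [if_neg hu, this, zero_add, zero_add, hf0, zero_add]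
      by_cases hu2 : u < a
      · rw [if_pos hu2, Set.indicator_of_mem (show u ∈ Set.Ico (b : ℝ) a from ⟨not_lt.1 hu, hu2⟩)]
      · rw [if_neg hu2, Set.indicator_of_notMem (by simp [not_lt.1 hu2]), hf0]
  have hind : IntegrableOn ((Set.Ico (b : ℝ) a).indicator fun _ => f v) (Set.Ioi 0) := by
    refine Integrable.integrableOn ?_
    rw [integrable_indicator_iff measurableSet_Ico]
    exact integrableOn_const (by simp)
  rw [jointExponent, jointExponent]
  simp_rw [key]
  rw [integral_add (integrableOn_comp_tailSum hf hf0 _) hind]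
  congr 1
  exact integral_Ioi_indicator_Ico hab _

/-- Extending a law by one further increment after all times considered so far. -/
lemma HasLevyLaws.exists_insert (hf : Continuous f) (hf0 : f 0 = 0)
    (hμ : ∀ t : ℝ≥0, ∃ μ : Measure E, IsProbabilityMeasure μ ∧
      ∀ z, charFun μ z = Complex.exp (-(t * f z)))
    {P : Measure (ℝ≥0 → E)} [IsProbabilityMeasure P] {I : Set ℝ≥0} (hP : HasLevyLaws f P I)
    {a b : ℝ≥0} (hb : b ∈ I) (hI : ∀ t ∈ I, t ≤ b) (hab : b < a) :
    ∃ P' : Measure (ℝ≥0 → E), IsProbabilityMeasure P' ∧ HasLevyLaws f P' (insert a I) := by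
  obtain ⟨μ, hμp, hμc⟩ := hμ (a - b)
  let g : (ℝ≥0 → E) × E → ℝ≥0 → E := fun p => Function.update p.1 a (p.1 b + p.2)
  have hg : Measurable g := by
    refine measurable_pi_lambda _ fun t => ?_
    by_cases h : t = a
    · subst h
      simp only [g, Function.update_self]
      fun_prop
    · simp only [g, Function.update_of_ne h]
      fun_prop
  refine ⟨(P.prod μ).map g, Measure.isProbabilityMeasure_map hg.aemeasurable, fun θ hθ => ?_⟩
  have haI : a ∉ I := fun h => absurd (hI a h) (not_le.2 hab)
  have hsplit : θ = θ.erase a + Finsupp.single a (θ a) := (Finsupp.erase_add_single a θ).symm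
  have hsupp : ∀ t ∈ (θ.erase a).support, t ∈ I := by
    intro t ht
    rw [Finsupp.support_erase] at ht
    exact (hθ (Finset.mem_of_mem_erase ht)).resolve_left (Finset.ne_of_mem_erase ht)
  -- As the new value at `a` is the value at `b` plus an independent increment, the frequency `θ a`
  -- moves to time `b` and also tests the increment.
  have hpair : ∀ p : (ℝ≥0 → E) × E, pathPairing (g p) θ
      = pathPairing p.1 (θ.erase a + Finsupp.single b (θ a)) + inner ℝ p.2 (θ a) := by
    intro p
    have h1 : pathPairing (g p) (θ.erase a) = pathPairing p.1 (θ.erase a) := by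
      rw [pathPairing_eq_sum, pathPairing_eq_sum]
      refine Finset.sum_congr rfl fun t ht => ?_
      have : t ≠ a := fun h => haI (h ▸ hsupp t ht)
      simp only [g, Function.update_of_ne this]
    nth_rewrite 1 [hsplit]
    rw [map_add, map_add, h1, pathPairing_single, pathPairing_single]
    simp only [g, Function.update_self, inner_add_left]
    ring
  have hm : AEStronglyMeasurable
      (fun x : ℝ≥0 → E => Complex.exp (Complex.I * (pathPairing x θ : ℝ)))
      ((P.prod μ).map g) := by
    have := measurable_pathPairing (E := E) θ
    exact Measurable.aestronglyMeasurable (by fun_prop)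
  rw [integral_map hg.aemeasurable hm]
  simp_rw [hpair]
  push_cast
  simp_rw [mul_add, Complex.exp_add]
  rw [integral_prod_mul (fun x : ℝ≥0 → E => Complex.exp (Complex.I *
      (pathPairing x (θ.erase a + Finsupp.single b (θ a)) : ℝ)))
    (fun y : E => Complex.exp (Complex.I * (inner ℝ y (θ a) : ℝ))),
    integral_exp_inner_eq_charFun, hμc, hP, ← Complex.exp_add]
  · have hj := jointExponent_add_single hf hf0 hab.le (fun t ht => hI t (hsupp t ht)) (θ a)
    rw [← hsplit] at hj
    rw [hj]
    congr 1
    ring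
  · refine (Finset.coe_subset.2 Finsupp.support_add).trans ?_
    intro t ht
    rcases Finset.mem_union.1 ht with h | h
    · exact hsupp t h
    · have := Finsupp.support_single_subset h
      rw [Finset.mem_singleton.1 this]; exact hb

/-- The times are added in increasing order. Time `0` is always present, so that each new time has a
predecessor from which to take an increment. -/
lemma exists_hasLevyLaws_finset (hf : Continuous f) (hf0 : f 0 = 0)
    (hμ : ∀ t : ℝ≥0, ∃ μ : Measure E, IsProbabilityMeasure μ ∧
      ∀ z, charFun μ z = Complex.exp (-(t * f z))) (I : Finset ℝ≥0) :
    ∃ P : Measure (ℝ≥0 → E), IsProbabilityMeasure P ∧ HasLevyLaws f P (insert 0 I) := by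
  induction I using Finset.induction_on_max with
  | empty =>
    refine ⟨Measure.dirac 0, inferInstance, fun θ hθ => ?_⟩
    have h0 : ∀ t ∈ θ.support, t = 0 := fun t ht => by simpa using hθ ht
    have h1 : jointExponent f θ = 0 := by
      rw [jointExponent]
      refine integral_eq_zero_of_ae ?_
      filter_upwards [ae_restrict_mem measurableSet_Ioi] with u hu
      rw [tailSum_eq_zero (fun t ht => by rw [h0 t ht]; exact le_of_lt hu), hf0]
      rfl
    have hm : StronglyMeasurable
        (fun x : ℝ≥0 → E => Complex.exp (Complex.I * (pathPairing x θ : ℝ))) := by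
      have := measurable_pathPairing (E := E) θ
      exact Measurable.stronglyMeasurable (by fun_prop)
    rw [h1, integral_dirac' _ _ hm, pathPairing_eq_sum]
    simp
  | insert a I ha ih =>
    obtain ⟨P, hP, hL⟩ := ih
    rcases eq_or_lt_of_le (zero_le (a := a)) with h | h
    · exact ⟨P, hP, by rw [← h]; simpa using hL⟩
    · have hne : (insert 0 I).Nonempty := ⟨0, Finset.mem_insert_self _ _⟩
      have hlt : (insert 0 I).max' hne < a := by
        rw [Finset.max'_lt_iff]
        intro t ht
        rcases Finset.mem_insert.1 ht with rfl | ht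
        · exact h
        · exact ha t ht
      obtain ⟨P', hP', hL'⟩ := hL.exists_insert hf hf0 hμ (b := (insert 0 I).max' hne)
        (by exact_mod_cast Finset.max'_mem _ hne)
        (fun t ht => Finset.le_max' _ _ (by exact_mod_cast ht)) hlt
      refine ⟨P', hP', ?_⟩
      rw [Set.insert_comm, ← Finset.coe_insert] at hL'
      exact hL'

/-- The joint characteristic function determines the finite-dimensional laws. -/
lemma HasLevyLaws.map_restrict_eq [CompleteSpace E]
    {P Q : Measure (ℝ≥0 → E)} [IsProbabilityMeasure P] [IsProbabilityMeasure Q] {J : Finset ℝ≥0}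
    (hP : HasLevyLaws f P J) (hQ : HasLevyLaws f Q J) :
    P.map J.restrict = Q.map J.restrict := by
  have hr : Measurable (J.restrict : (ℝ≥0 → E) → J → E) := Finset.measurable_restrict J
  -- The finite product is given its `ℓ²` structure because characteristic functions need an inner
  -- product.
  have key : ∀ R : Measure (ℝ≥0 → E), HasLevyLaws f R J → ∀ θ : PiLp 2 fun _ : J => E,
      charFun ((R.map J.restrict).map (MeasurableEquiv.toLp 2 (J → E))) θ
        = Complex.exp (-jointExponent f (∑ j : J, Finsupp.single (j : ℝ≥0) (θ j))) := by
    intro R hR θ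
    rw [← hR, Measure.map_map (by fun_prop) hr, charFun_apply, integral_map
      ((MeasurableEquiv.toLp 2 (J → E)).measurable.comp hr).aemeasurable
      (Continuous.aestronglyMeasurable (by fun_prop))]
    · refine integral_congr_ae (Eventually.of_forall fun x => ?_)
      simp only [map_sum, pathPairing_single, PiLp.inner_apply, Function.comp_apply]
      rw [mul_comm]
      rfl
    · intro t ht
      obtain ⟨j, -, hj⟩ := Finset.mem_biUnion.1 (Finsupp.support_finsetSum ht)
      rw [Finset.mem_singleton.1 (Finsupp.support_single_subset hj)]
      exact j.2
  have := Measure.isProbabilityMeasure_map (μ := P) hr.aemeasurable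
  have := Measure.isProbabilityMeasure_map (μ := Q) hr.aemeasurable
  have hmap : (P.map J.restrict).map (MeasurableEquiv.toLp 2 (J → E))
      = (Q.map J.restrict).map (MeasurableEquiv.toLp 2 (J → E)) := by
    have := Measure.isProbabilityMeasure_map (μ := P.map J.restrict)
      (MeasurableEquiv.toLp 2 (J → E)).measurable.aemeasurable
    have := Measure.isProbabilityMeasure_map (μ := Q.map J.restrict)
      (MeasurableEquiv.toLp 2 (J → E)).measurable.aemeasurable
    refine Measure.ext_of_charFun ?_
    ext θ
    rw [key P hP, key Q hQ]
  exact (MeasurableEquiv.toLp 2 (J → E)).map_measurableEquiv_injective hmap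

/-- **Existence of Lévy processes**, as a law on path space. -/
theorem exists_hasLevyLaws [CompleteSpace E]
    (hf : Continuous f) (hf0 : f 0 = 0)
    (hμ : ∀ t : ℝ≥0, ∃ μ : Measure E, IsProbabilityMeasure μ ∧
      ∀ z, charFun μ z = Complex.exp (-(t * f z))) :
    ∃ P : Measure (ℝ≥0 → E), IsProbabilityMeasure P ∧ HasLevyLaws f P Set.univ := by
  choose P hP hL using fun I : Finset ℝ≥0 => exists_hasLevyLaws_finset hf hf0 hμ I
  have hr : ∀ J : Finset ℝ≥0, Measurable (J.restrict : (ℝ≥0 → E) → J → E) :=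
    Finset.measurable_restrict
  have hprob : ∀ J : Finset ℝ≥0, IsProbabilityMeasure ((P J).map J.restrict) := fun J =>
    Measure.isProbabilityMeasure_map (hr J).aemeasurable
  -- The laws `P J` are chosen separately for each `J`; they are consistent because the joint
  -- characteristic function determines them.
  have hproj : IsProjectiveMeasureFamily (α := fun _ : ℝ≥0 => E)
      fun J => (P J).map J.restrict := by
    intro I J hJI
    have h1 : (P J).map J.restrict = (P I).map J.restrict :=
      ((hL J).mono (Set.subset_insert _ _)).map_restrict_eq
        ((hL I).mono ((Finset.coe_subset.2 hJI).trans (Set.subset_insert _ _)))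
    exact h1.trans (Measure.map_map
      (Finset.measurable_restrict₂ (X := fun _ : ℝ≥0 => E) hJI) (hr I)).symm
  obtain ⟨Q, hQ⟩ := exists_isProjectiveLimit hproj
  have hQp : IsProbabilityMeasure Q := hQ.isProbabilityMeasure
  refine ⟨Q, hQp, fun θ _ => ?_⟩
  let h : (θ.support → E) → ℂ := fun y =>
    Complex.exp (Complex.I * (∑ t : θ.support, inner ℝ (y t) (θ t) : ℝ))
  have hh : Measurable h := Continuous.measurable (by fun_prop)
  have hres : ∀ x : ℝ≥0 → E, Complex.exp (Complex.I * (pathPairing x θ : ℝ))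
      = h (θ.support.restrict x) := by
    intro x
    rw [pathPairing_eq_sum, ← Finset.sum_coe_sort]
    rfl
  have hchange : ∀ ρ : Measure (ℝ≥0 → E),
      ∫ x, Complex.exp (Complex.I * (pathPairing x θ : ℝ)) ∂ρ
        = ∫ y, h y ∂(ρ.map θ.support.restrict) := by
    intro ρ
    rw [integral_map (hr _).aemeasurable hh.aestronglyMeasurable]
    simp_rw [hres]
  rw [hchange, hQ θ.support, ← hchange]
  exact hL θ.support θ (Set.subset_insert _ _)

end FiniteDimensionalLaws

/-! ### Increments and stochastic continuity from the joint characteristic function. -/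

section LevyProcess

open Filter Topology

/-- The tail sum is the step function equal to `η k` on the `k`-th interval. These intervals are
disjoint, so `f` of the sum is the sum of the values of `f`. -/
lemma jointExponent_increments {E : Type*} [NormedAddCommGroup E] [InnerProductSpace ℝ E]
    {f : E → ℂ} (hf0 : f 0 = 0) {n : ℕ} {t : Fin (n + 1) → ℝ≥0} (ht : Monotone t)
    (η : Fin n → E) :
    jointExponent f (∑ k, (Finsupp.single (t k.succ) (η k) - Finsupp.single (t k.castSucc) (η k)))
      = ∑ k, ((t k.succ - t k.castSucc : ℝ≥0) : ℝ) * f (η k) := by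
  have hle : ∀ k : Fin n, t k.castSucc ≤ t k.succ := fun k => ht (Fin.castSucc_lt_succ).le
  have hdisj : ∀ (u : ℝ) (k l : Fin n), u ∈ Set.Ico (t k.castSucc : ℝ) (t k.succ) →
      u ∈ Set.Ico (t l.castSucc : ℝ) (t l.succ) → k ≤ l := by
    intro u k l hk hl
    by_contra! h
    have : t l.succ ≤ t k.castSucc := ht (Fin.succ_le_castSucc_iff.2 h)
    exact absurd (hl.2.trans_le (NNReal.coe_le_coe.2 this)) (not_lt.2 hk.1)
  have key : ∀ u : ℝ, f (tailSum u (∑ k, (Finsupp.single (t k.succ) (η k)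
      - Finsupp.single (t k.castSucc) (η k))))
      = ∑ k, (Set.Ico (t k.castSucc : ℝ) (t k.succ)).indicator (fun _ => f (η k)) u := by
    intro u
    have h1 : tailSum u (∑ k, (Finsupp.single (t k.succ) (η k)
        - Finsupp.single (t k.castSucc) (η k)))
        = ∑ k, (Set.Ico (t k.castSucc : ℝ) (t k.succ)).indicator (fun _ => η k) u := by
      rw [map_sum]
      refine Finset.sum_congr rfl fun k _ => ?_
      rw [map_sub, tailSum_single, tailSum_single, Set.indicator_apply]
      have h3 : (t k.castSucc : ℝ) ≤ t k.succ := hle k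
      by_cases ha : u < t k.castSucc
      · have hb : u < t k.succ := ha.trans_le h3
        simp [ha, hb]
      · by_cases hb : u < t k.succ
        · simp [ha, hb, not_lt.1 ha]
        · simp [ha, hb]
    rw [h1]
    by_cases h : ∃ k : Fin n, u ∈ Set.Ico (t k.castSucc : ℝ) (t k.succ)
    · obtain ⟨k, hk⟩ := h
      have hne : ∀ l : Fin n, l ≠ k → u ∉ Set.Ico (t l.castSucc : ℝ) (t l.succ) :=
        fun l hl h => hl (le_antisymm (hdisj u l k h hk) (hdisj u k l hk h))
      rw [Finset.sum_eq_single k (fun l _ hl => Set.indicator_of_notMem (hne l hl) _) (by simp),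
        Finset.sum_eq_single k (fun l _ hl => Set.indicator_of_notMem (hne l hl) _) (by simp),
        Set.indicator_of_mem hk, Set.indicator_of_mem hk]
    · have h' : ∀ k : Fin n, u ∉ Set.Ico (t k.castSucc : ℝ) (t k.succ) := by simpa using h
      rw [Finset.sum_eq_zero fun k _ => Set.indicator_of_notMem (h' k) _,
        Finset.sum_eq_zero fun k _ => Set.indicator_of_notMem (h' k) _, hf0]
  rw [jointExponent]
  simp_rw [key]
  rw [integral_finsetSum]
  · exact Finset.sum_congr rfl fun k _ => integral_Ioi_indicator_Ico (hle k) _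
  · intro k _
    refine Integrable.integrableOn ?_
    rw [integrable_indicator_iff measurableSet_Ico]
    exact integrableOn_const (by simp)

variable {Ω : Type*} [MeasurableSpace Ω] {P : Measure Ω}
  {E : Type*} [NormedAddCommGroup E] [InnerProductSpace ℝ E]
  [MeasurableSpace E] [BorelSpace E] {f : E → ℂ}

/-- Convergence in law to `0`, and hence in probability, for characteristic functions
`exp (-t f)` as `t → 0`. -/
lemma tendsto_measure_lt_norm [FiniteDimensional ℝ E] {μ : ℝ≥0 → Measure E} [∀ t, IsProbabilityMeasure (μ t)]
    (hμ : ∀ t z, charFun (μ t) z = Complex.exp (-(t * f z))) {η : ℝ} (hη : 0 < η) :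
    Tendsto (fun t => μ t {x | η < ‖x‖}) (𝓝 0) (𝓝 0) := by
  refine tendsto_of_seq_tendsto fun u hu => ?_
  let p : ℕ → ProbabilityMeasure E := fun n => ⟨μ (u n), inferInstance⟩
  let p₀ : ProbabilityMeasure E := ⟨Measure.dirac 0, inferInstance⟩
  have hp : Tendsto p atTop (𝓝 p₀) := by
    refine ProbabilityMeasure.tendsto_of_tendsto_charFun fun z => ?_
    have e : charFun ((p₀ : ProbabilityMeasure E) : Measure E) z
        = Complex.exp (-(((0 : ℝ≥0) : ℝ) * f z)) := by
      change charFun (Measure.dirac (0 : E)) z = _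
      simp
    rw [e]
    change Tendsto (fun n => charFun (μ (u n)) z) atTop _
    simp_rw [hμ]
    have hc : Continuous fun t : ℝ≥0 => Complex.exp (-((t : ℝ) * f z)) := by fun_prop
    exact (hc.tendsto 0).comp hu
  -- The frontier lies in the sphere of radius `η > 0`, which misses the atom at `0`, so the
  -- portmanteau theorem applies.
  have hfr : (p₀ : Measure E) (frontier {x | η < ‖x‖}) = 0 := by
    refine measure_mono_null (frontier_lt_subset_eq continuous_const continuous_norm) ?_
    change Measure.dirac (0 : E) _ = 0
    rw [Measure.dirac_apply' _ (measurableSet_eq_fun measurable_const measurable_norm)]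
    simp [hη.ne']
  have := ProbabilityMeasure.tendsto_measure_of_null_frontier_of_tendsto' hp hfr
  have e0 : (p₀ : Measure E) {x | η < ‖x‖} = 0 := by
    change Measure.dirac (0 : E) _ = 0
    rw [Measure.dirac_apply' _ (measurableSet_lt measurable_const measurable_norm)]
    simp [hη.le]
  rw [e0] at this
  exact this

variable {X : ℝ≥0 → Ω → E}

lemma charFun_map_eval (hf0 : f 0 = 0) (hX : ∀ t, Measurable (X t))
    (h : ∀ θ, ∫ ω, Complex.exp (Complex.I * (pathPairing (fun t => X t ω) θ : ℝ)) ∂P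
      = Complex.exp (-jointExponent f θ)) (t : ℝ≥0) (z : E) :
    charFun (P.map (X t)) z = Complex.exp (-((t : ℝ) * f z)) := by
  rw [← jointExponent_single hf0, ← h, charFun_apply, integral_map (hX t).aemeasurable
    (Continuous.aestronglyMeasurable (by fun_prop))]
  refine integral_congr_ae (Eventually.of_forall fun ω => ?_)
  simp only [pathPairing_single]
  rw [mul_comm]

variable [SecondCountableTopology E]

/-- The product form is the factorization that characterizes independence of the increments. -/
lemma charFun_map_increment (hf0 : f 0 = 0) (hX : ∀ t, Measurable (X t))
    (h : ∀ θ, ∫ ω, Complex.exp (Complex.I * (pathPairing (fun t => X t ω) θ : ℝ)) ∂P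
      = Complex.exp (-jointExponent f θ)) {n : ℕ} {t : Fin (n + 1) → ℝ≥0} (ht : Monotone t)
    (η : PiLp 2 fun _ : Fin n => E) :
    charFun (P.map fun ω => WithLp.toLp 2 fun k : Fin n => X (t k.succ) ω - X (t k.castSucc) ω) η
      = ∏ k, Complex.exp (-(((t k.succ - t k.castSucc : ℝ≥0) : ℝ) * f (η k))) := by
  have hm : Measurable fun ω => WithLp.toLp 2 fun k : Fin n => X (t k.succ) ω - X (t k.castSucc) ω :=
    (MeasurableEquiv.toLp 2 (Fin n → E)).measurable.comp
      (measurable_pi_lambda _ fun k => (hX _).sub (hX _))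
  rw [← Complex.exp_sum, Finset.sum_neg_distrib, ← jointExponent_increments hf0 ht, ← h,
    charFun_apply, integral_map hm.aemeasurable (Continuous.aestronglyMeasurable (by fun_prop))]
  refine integral_congr_ae (Eventually.of_forall fun ω => ?_)
  simp only [map_sum, map_sub, pathPairing_single, PiLp.inner_apply, ← inner_sub_left]
  rw [mul_comm]

lemma charFun_map_sub (hf0 : f 0 = 0) (hX : ∀ t, Measurable (X t))
    (h : ∀ θ, ∫ ω, Complex.exp (Complex.I * (pathPairing (fun t => X t ω) θ : ℝ)) ∂P
      = Complex.exp (-jointExponent f θ)) {s t : ℝ≥0} (hst : s ≤ t) (z : E) :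
    charFun (P.map fun ω => X t ω - X s ω) z
      = Complex.exp (-(((t - s : ℝ≥0) : ℝ) * f z)) := by
  have hm : Measurable fun ω => X t ω - X s ω := (hX _).sub (hX _)
  have hj := jointExponent_increments (n := 1) hf0 (t := ![s, t])
    (by intro i j hij; fin_cases i <;> fin_cases j <;> simp_all) ![z]
  simp only [Finset.univ_unique, Fin.default_eq_zero, Finset.sum_singleton, Fin.succ_zero_eq_one,
    Matrix.cons_val_one, Matrix.cons_val_zero, Fin.castSucc_zero] at hj
  rw [← hj, ← h, charFun_apply, integral_map hm.aemeasurable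
    (Continuous.aestronglyMeasurable (by fun_prop))]
  refine integral_congr_ae (Eventually.of_forall fun ω => ?_)
  simp only [map_sub, pathPairing_single, inner_sub_left]
  rw [mul_comm]

end LevyProcess

/-! ### Existence of independent copies. -/

section Copies

open Filter Topology

variable {Ω : Type*} [MeasurableSpace Ω] {P : Measure Ω} {d : ℕ}
  {X : ℝ≥0 → Ω → EuclideanSpace ℝ (Fin d)} {f : EuclideanSpace ℝ (Fin d) → ℂ}

/-- The joint characteristic function identifies a Lévy process. -/
theorem isLevyProcess_of_joint [IsProbabilityMeasure P] (hf0 : f 0 = 0) (hX : ∀ t, Measurable (X t))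
    (h : ∀ θ, ∫ ω, Complex.exp (Complex.I * (pathPairing (fun t => X t ω) θ : ℝ)) ∂P
      = Complex.exp (-jointExponent f θ)) : IsLevyProcess X P := by
  have hprob : ∀ t, IsProbabilityMeasure (P.map (X t)) := fun t =>
    Measure.isProbabilityMeasure_map (hX t).aemeasurable
  refine ⟨hX, fun s t => ?_, fun n t ht => ?_, ?_, fun η hη => ?_⟩
  · have hm : Measurable fun ω => X (t + s) ω - X t ω := (hX _).sub (hX _)
    have := Measure.isProbabilityMeasure_map (μ := P) hm.aemeasurable
    refine ⟨hm.aemeasurable, (hX s).aemeasurable, Measure.ext_of_charFun ?_⟩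
    ext z
    rw [charFun_map_sub hf0 hX h le_self_add, charFun_map_eval hf0 hX h, add_tsub_cancel_left]
  · have hm : ∀ k : Fin n, AEMeasurable (fun ω => X (t k.succ) ω - X (t k.castSucc) ω) P :=
      fun k => ((hX _).sub (hX _)).aemeasurable
    rw [iIndepFun_iff_charFun_pi hm]
    intro η
    rw [charFun_map_increment hf0 hX h ht]
    refine Finset.prod_congr rfl fun k _ => ?_
    exact (charFun_map_sub hf0 hX h (ht (Fin.castSucc_lt_succ).le) _).symm
  · have h0 : P.map (X 0) = Measure.dirac 0 := by
      refine Measure.ext_of_charFun ?_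
      ext z
      rw [charFun_map_eval hf0 hX h]
      simp
    have h1 : ∀ᵐ x ∂(P.map (X 0)), x = 0 := by
      rw [h0]
      exact (ae_dirac_iff (p := fun x => x = 0) (measurableSet_singleton 0)).2 rfl
    exact ae_of_ae_map (hX 0).aemeasurable h1
  · have := tendsto_measure_lt_norm (μ := fun t => P.map (X t)) (f := f)
      (charFun_map_eval hf0 hX h) hη
    refine (this.mono_left nhdsWithin_le_nhds).congr fun t => ?_
    rw [Measure.map_apply (hX t) (measurableSet_lt measurable_const measurable_norm)]
    rfl

lemma hasCharExponent_of_joint (hf0 : f 0 = 0)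
    (h : ∀ θ, ∫ ω, Complex.exp (Complex.I * (pathPairing (fun t => X t ω) θ : ℝ)) ∂P
      = Complex.exp (-jointExponent f θ)) : HasCharExponent X P f := by
  intro t z
  have := h (Finsupp.single t z)
  rw [jointExponent_single hf0] at this
  simp only [pathPairing_single] at this
  rw [this, neg_mul]

/-- **Existence of i.i.d. copies of a Lévy process** with a given Lévy–Khintchine exponent. -/
theorem exists_isLevyCopies {A : Matrix (Fin d) (Fin d) ℝ} (hA : A.PosSemidef)
    (γ : EuclideanSpace ℝ (Fin d)) {ν : Measure (EuclideanSpace ℝ (Fin d))}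
    (hν : IsJumpMeasure ν) (n m : ℕ) :
    ∃ (Ω : Type) (_ : MeasurableSpace Ω) (P : Measure Ω) (_ : IsProbabilityMeasure P)
      (X : Fin n → Fin m → ℝ≥0 → Ω → EuclideanSpace ℝ (Fin d)),
      IsLevyCopies X P (levyExponent A γ ν) := by
  have hf0 := levyExponent_zero A γ ν
  obtain ⟨Q, hQ, hL⟩ := exists_hasLevyLaws (continuous_levyExponent A γ hν) hf0
    (exists_charFun_eq_exp_neg_mul_levyExponent hA γ hν)
  let P : Measure (Fin n × Fin m → ℝ≥0 → EuclideanSpace ℝ (Fin d)) :=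
    Measure.infinitePi fun _ => Q
  have hX : ∀ (v : Fin n) (j : Fin m) (t : ℝ≥0),
      Measurable fun ω : Fin n × Fin m → ℝ≥0 → EuclideanSpace ℝ (Fin d) => ω (v, j) t := by
    fun_prop
  have hjoint : ∀ (v : Fin n) (j : Fin m) (θ : ℝ≥0 →₀ EuclideanSpace ℝ (Fin d)),
      ∫ ω, Complex.exp (Complex.I * (pathPairing (fun t => ω (v, j) t) θ : ℝ)) ∂P
        = Complex.exp (-jointExponent (levyExponent A γ ν) θ) := by
    intro v j θ
    rw [← hL θ (Set.subset_univ _)]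
    have hmp := measurePreserving_eval_infinitePi
      (fun _ : Fin n × Fin m => Q) (v, j)
    have hm : Measurable fun x : ℝ≥0 → EuclideanSpace ℝ (Fin d) =>
        Complex.exp (Complex.I * (pathPairing x θ : ℝ)) := by
      have := measurable_pathPairing θ
      fun_prop
    rw [← hmp.map_eq, integral_map hmp.measurable.aemeasurable hm.aestronglyMeasurable]
  refine ⟨_, inferInstance, P, inferInstance, fun v j t ω => ω (v, j) t, ?_, ?_, ?_⟩
  · exact fun v j => isLevyProcess_of_joint hf0 (hX v j) (hjoint v j)
  · exact fun v j => hasCharExponent_of_joint hf0 (hjoint v j)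
  · exact iIndepFun_infinitePi (P := fun _ : Fin n × Fin m => Q)
      (X := fun _ x => x) (fun _ => measurable_id)

end Copies

/-! ### Parameter estimates for size, word length and rounding. -/

section Parameters

lemma le_two_pow_of_logb_le {x : ℝ} (hx : 0 < x) {K : ℕ} (h : Real.logb 2 x ≤ K) :
    x ≤ 2 ^ K := by
  rw [Real.logb_le_iff_le_rpow (by norm_num) hx, Real.rpow_natCast] at h
  exact h

lemma one_le_logb_two {x : ℝ} (hx : 2 ≤ x) : 1 ≤ Real.logb 2 x := by
  rw [Real.le_logb_iff_rpow_le (by norm_num) (by linarith)]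
  simpa using hx

/-- The number of registers is `O(ε⁻² log n)`. -/
lemma card_registers_le {c n : ℕ} (hn : 2 ≤ n) {ε : ℝ} (h0 : 0 < ε) (h1 : ε ≤ 1) :
    ((Fintype.card (Fin (⌈c * Real.logb 2 n⌉₊ + 1) × Fin ⌈(2400 / ε) ^ 2⌉₊) : ℕ) : ℝ)
      ≤ (c + 11) * (2400 ^ 2 + 1) / Real.log 2 * (ε⁻¹ ^ 2 * Real.log n) := by
  have hlog2 : 0 < Real.log 2 := Real.log_pos (by norm_num)
  have hL : 1 ≤ Real.logb 2 n := one_le_logb_two (by exact_mod_cast hn)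
  have hK : (⌈c * Real.logb 2 n⌉₊ : ℝ) ≤ c * Real.logb 2 n + 1 :=
    (Nat.ceil_lt_add_one (by positivity)).le
  have hm : (⌈(2400 / ε) ^ 2⌉₊ : ℝ) ≤ (2400 ^ 2 + 1) * ε⁻¹ ^ 2 := by
    have h2 := (Nat.ceil_lt_add_one (a := (2400 / ε) ^ 2) (by positivity)).le
    have h3 : 1 ≤ ε⁻¹ := (one_le_inv₀ h0).2 h1
    have h4 : 1 ≤ ε⁻¹ ^ 2 := one_le_pow₀ h3
    have e : (2400 / ε) ^ 2 = 2400 ^ 2 * ε⁻¹ ^ 2 := by rw [div_eq_mul_inv, mul_pow]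
    rw [e] at h2 ⊢
    linarith
  rw [Fintype.card_prod, Fintype.card_fin, Fintype.card_fin]
  push_cast
  calc ((⌈c * Real.logb 2 n⌉₊ : ℝ) + 1) * ⌈(2400 / ε) ^ 2⌉₊
      ≤ ((c + 11) * Real.logb 2 n) * ((2400 ^ 2 + 1) * ε⁻¹ ^ 2) := by
        gcongr
        linarith
    _ = _ := by
        rw [Real.logb]
        field_simp

lemma bits_le {c n : ℕ} (hn : 2 ≤ n) {ε : ℝ} (h0 : 0 < ε) (h1 : ε ≤ 1) :
    (⌈Real.logb 2 (400 * n ^ c / ε)⌉₊ : ℝ)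
      ≤ (c + 11) * (2400 ^ 2 + 1) / Real.log 2 * Real.log (n / ε) := by
  have hlog2 : 0 < Real.log 2 := Real.log_pos (by norm_num)
  have hn' : (2 : ℝ) ≤ n := by exact_mod_cast hn
  have hn0 : (0 : ℝ) < n := by linarith
  have hnε : (n : ℝ) ≤ n / ε := by
    rw [le_div_iff₀ h0]; nlinarith
  have hM : 1 ≤ Real.logb 2 (n / ε) := one_le_logb_two (hn'.trans hnε)
  have hL : Real.logb 2 n ≤ Real.logb 2 (n / ε) :=
    Real.logb_le_logb_of_le (by norm_num) hn0 hnε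
  have hL1 : 1 ≤ Real.logb 2 n := one_le_logb_two hn'
  have h400 : Real.logb 2 400 ≤ 9 := by
    rw [Real.logb_le_iff_le_rpow (by norm_num) (by norm_num)]
    norm_num
  have e : Real.logb 2 (400 * n ^ c / ε)
      = Real.logb 2 400 + c * Real.logb 2 n + (Real.logb 2 (n / ε) - Real.logb 2 n) := by
    rw [Real.logb_div (by positivity) h0.ne', Real.logb_mul (by norm_num) (by positivity),
      Real.logb_pow, Real.logb_div hn0.ne' h0.ne']
    ring
  have hpos : 0 ≤ Real.logb 2 (400 * n ^ c / ε) := by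
    refine Real.logb_nonneg (by norm_num) ?_
    rw [le_div_iff₀ h0]
    have : (1 : ℝ) ≤ n ^ c := one_le_pow₀ (by linarith)
    linarith
  have hb := (Nat.ceil_lt_add_one hpos).le
  have hc : (c : ℝ) * Real.logb 2 n ≤ c * Real.logb 2 (n / ε) := by gcongr
  -- Besides `c` there is `9` for `log₂ 400`, one for the ceiling and one for `log₂ (n/ε)`. The
  -- further factor `2400² + 1` only matches the constant of the word count.
  calc (⌈Real.logb 2 (400 * n ^ c / ε)⌉₊ : ℝ) ≤ (c + 11) * Real.logb 2 (n / ε) := by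
        rw [e] at hb
        rw [e]
        linarith
    _ ≤ (c + 11) * Real.logb 2 (n / ε) * (2400 ^ 2 + 1) := by
        refine le_mul_of_one_le_right (by positivity) (by norm_num)
    _ = _ := by
        rw [Real.logb]
        field_simp

/-- The word length makes `2ᵇ ≥ 400 nᶜ / ε`, and `π / 400 ≤ 1 / 120`. -/
lemma rounding_le {c n : ℕ} (hn : 2 ≤ n) {ε : ℝ} (h0 : 0 < ε) {N : ℕ} (hN : N ≤ n ^ c) :
    (N : ℝ) * (Real.pi / 2 ^ ⌈Real.logb 2 (400 * n ^ c / ε)⌉₊) ≤ ε / 120 := by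
  have hn0 : (0 : ℝ) < n := by
    have : 0 < n := by omega
    exact_mod_cast this
  have hp : (0 : ℝ) < n ^ c := by positivity
  have h2 : 400 * n ^ c / ε ≤ (2 : ℝ) ^ ⌈Real.logb 2 (400 * n ^ c / ε)⌉₊ :=
    le_two_pow_of_logb_le (by positivity) (Nat.le_ceil _)
  have hN' : (N : ℝ) ≤ n ^ c := by exact_mod_cast hN
  have hpi := Real.pi_lt_d2
  have hpi0 := Real.pi_pos
  calc (N : ℝ) * (Real.pi / 2 ^ ⌈Real.logb 2 (400 * n ^ c / ε)⌉₊)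
      ≤ n ^ c * (Real.pi / (400 * n ^ c / ε)) := by gcongr
    _ = Real.pi * ε / 400 := by field_simp
    _ ≤ ε / 120 := by nlinarith

end Parameters

end LevySketch

/-! ### The main theorem. -/

open LevySketch
theorem theorem1 :
    -- The estimation guarantee, with absolute constants `C` and `m₀`.
    (∃ (C : ℝ) (m₀ : ℕ), 0 < C ∧
      ∀ (d : ℕ) (A : Matrix (Fin d) (Fin d) ℝ) (γ : EuclideanSpace ℝ (Fin d))
        (ν : Measure (EuclideanSpace ℝ (Fin d))), A.PosSemidef → IsJumpMeasure ν →
      ∀ n m K : ℕ, m₀ ≤ m →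
      ∀ (Ω : Type*) [MeasurableSpace Ω] (P : Measure Ω) [IsProbabilityMeasure P]
        (X : Fin n → Fin m → ℝ≥0 → Ω → EuclideanSpace ℝ (Fin d)),
        IsLevyCopies X P (levyExponent A γ ν) →
      ∀ σ : List (Fin n × EuclideanSpace ℝ (Fin d)),
        1 ≤ ‖fMoment (levyExponent A γ ν) (frequency σ)‖ →
        Real.logb 2 ‖fMoment (levyExponent A γ ν) (frequency σ)‖ ≤ K →
        99 / 100 ≤ P {ω | ‖(levyTower X K).output ω σ
              - fMoment (levyExponent A γ ν) (frequency σ)‖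
            ≤ C * (‖fMoment (levyExponent A γ ν) (frequency σ)‖ / √m)}) ∧
    -- Existence of a mergeable sketch of `O(ε⁻² log n)` words, for moments up to `n ^ c`.
    (∀ c : ℕ, ∃ C : ℝ, 0 < C ∧ ∀ (n : ℕ) (ε : ℝ), 2 ≤ n → 0 < ε → ε ≤ 1 →
      ∃ m K b : ℕ, (b : ℝ) ≤ C * Real.log (n / ε) ∧
      ∀ (d : ℕ) (A : Matrix (Fin d) (Fin d) ℝ) (γ : EuclideanSpace ℝ (Fin d))
        (ν : Measure (EuclideanSpace ℝ (Fin d))), A.PosSemidef → IsJumpMeasure ν →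
      (∃ (Ω : Type) (_ : MeasurableSpace Ω) (P : Measure Ω) (_ : IsProbabilityMeasure P)
        (X : Fin n → Fin m → ℝ≥0 → Ω → EuclideanSpace ℝ (Fin d)),
        IsLevyCopies X P (levyExponent A γ ν)) ∧
      ∀ (Ω : Type*) [MeasurableSpace Ω] (P : Measure Ω) [IsProbabilityMeasure P]
        (X : Fin n → Fin m → ℝ≥0 → Ω → EuclideanSpace ℝ (Fin d)),
        IsLevyCopies X P (levyExponent A γ ν) →
        -- Size and mergeability, with exact registers and with registers of `b` bits.
        ((levyTower X K).words : ℝ) ≤ C * (ε⁻¹ ^ 2 * Real.log n) ∧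
        (levyTower X K).Mergeable ∧
        ((levyTowerBits X K b).words : ℝ) ≤ C * (ε⁻¹ ^ 2 * Real.log n) ∧
        (levyTowerBits X K b).Mergeable ∧
        -- Accuracy on every stream whose moment lies in the range.
        ∀ σ : List (Fin n × EuclideanSpace ℝ (Fin d)),
          1 ≤ ‖fMoment (levyExponent A γ ν) (frequency σ)‖ →
          ‖fMoment (levyExponent A γ ν) (frequency σ)‖ ≤ (n : ℝ) ^ c →
          99 / 100 ≤ P {ω | ‖(levyTower X K).output ω σ
                - fMoment (levyExponent A γ ν) (frequency σ)‖
              ≤ ε * ‖fMoment (levyExponent A γ ν) (frequency σ)‖} ∧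
          (σ.length ≤ n ^ c →
            99 / 100 ≤ P {ω | ‖(levyTowerBits X K b).output ω σ
                  - fMoment (levyExponent A γ ν) (frequency σ)‖
                ≤ ε * ‖fMoment (levyExponent A γ ν) (frequency σ)‖})) := by
  -- With `δ = 20 / √m` one has `m δ² = 400` and `60 δ = 1200 / √m`; the condition `δ ≤ 1/40` means
  -- `m ≥ 800² = 640000`.
  refine ⟨⟨1200, 640000, by norm_num, ?_⟩, fun c => ?_⟩
  · intro d A γ ν hA hν n m K hm Ω _ P _ X hX σ hF hK
    have hm' : (640000 : ℝ) ≤ m := by exact_mod_cast hm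
    have hs : 800 ≤ √(m : ℝ) := Real.le_sqrt_of_sq_le (by linarith)
    have hs0 : 0 < √(m : ℝ) := by linarith
    have h := levyTower_accuracy hX (by omega) K σ hF
      (le_two_pow_of_logb_le (by linarith) hK) (δ := 20 / √(m : ℝ)) (by positivity)
      (by rw [div_le_iff₀ hs0]; linarith)
      (by rw [div_pow, Real.sq_sqrt (by linarith)]; field_simp; norm_num)
    refine h.trans (measure_mono fun ω hω => ?_)
    rw [Set.mem_ofPred_eq] at hω ⊢
    exact hω.trans (le_of_eq (by ring))
  · have hlog2 : 0 < Real.log 2 := Real.log_pos (by norm_num)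
    refine ⟨(c + 11) * (2400 ^ 2 + 1) / Real.log 2, by positivity, fun n ε hn h0 h1 => ?_⟩
    -- Sampling and rounding each receive `ε / 120`, so that `60 · (2ε / 120) = ε`; the requirement
    -- `m (ε / 120)² ≥ 400` gives `m ≥ (2400 / ε)²`.
    refine ⟨⌈(2400 / ε) ^ 2⌉₊, ⌈c * Real.logb 2 n⌉₊, ⌈Real.logb 2 (400 * n ^ c / ε)⌉₊,
      bits_le hn h0 h1, fun d A γ ν hA hν => ⟨exists_isLevyCopies hA γ hν _ _, ?_⟩⟩
    intro Ω _ P _ X hX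
    refine ⟨card_registers_le hn h0 h1, levyTower_mergeable X _, card_registers_le hn h0 h1,
      levyTowerBits_mergeable X _ _, fun σ hF hFn => ?_⟩
    have hn0 : (0 : ℝ) < n := by
      have : 0 < n := by omega
      exact_mod_cast this
    have hm : 0 < ⌈(2400 / ε) ^ 2⌉₊ := Nat.ceil_pos.2 (by positivity)
    have hK : ‖fMoment (levyExponent A γ ν) (frequency σ)‖ ≤ 2 ^ ⌈c * Real.logb 2 n⌉₊ := by
      refine hFn.trans (le_two_pow_of_logb_le (by positivity) ?_)
      rw [Real.logb_pow]
      exact Nat.le_ceil _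
    have hmδ : 400 ≤ (⌈(2400 / ε) ^ 2⌉₊ : ℝ) * (ε / 120) ^ 2 := by
      calc (400 : ℝ) = (2400 / ε) ^ 2 * (ε / 120) ^ 2 := by field_simp; norm_num
        _ ≤ _ := by gcongr; exact Nat.le_ceil _
    refine ⟨?_, fun hlen => ?_⟩
    · refine (levyTower_accuracy hX hm _ σ hF hK (δ := ε / 120) (by positivity) (by linarith)
        hmδ).trans (measure_mono fun ω hω => ?_)
      rw [Set.mem_ofPred_eq] at hω ⊢
      refine hω.trans ?_
      gcongr
      linarith
    · refine (levyTowerBits_accuracy hX hm _ _ σ hF hK (δ := ε / 120) (ρ := ε / 120)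
        (by positivity) (by linarith) hmδ (rounding_le hn h0 hlen)).trans
        (measure_mono fun ω hω => ?_)
      rw [Set.mem_ofPred_eq] at hω ⊢
      refine hω.trans ?_
      gcongr
      linarith
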